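/- Work with smooth (resp. complex) manifolds, i.e. finite-dimensional, Hausdorff and second countable, and with smooth (resp. holomorphic) maps. For a Lie groupoid $\Gamma\rightrightarrows M$ with source $s$ and target $t$, the product $\gamma_1\gamma_2$ is defined when $t(\gamma_1)=s(\gamma_2)$; left actions $\gamma\cdot x$ on $p:X\to M$ are defined when $t(\gamma)=p(x)$, with $p(\gamma\cdot x)=s(\gamma)$, and right actions $x\cdot\gamma'$ on $p':X\to M'$ when $p'(x)=s(\gamma')$, with $p'(x\cdot\gamma')=t(\gamma')$. A subset $S\subset M$ is $\Gamma$-stable if $t(\gamma)\in S\Leftrightarrow s(\gamma)\in S$ for all $\gamma\in\Gamma$. A Morita equivalence $\mathcal X$ between $\Gamma\rightrightarrows M$ and $\Gamma'\rightrightarrows M'$ is a manifold $X$ with surjective submersions $p:X\to M$, $p':X\to M'$ and commuting left $\Gamma$- and right $\Gamma'$-actions (along $p$ and $p'$) which preserve the fibres of $p'$ and $p$ respectively, and which are proper, free and transitive on these fibres. For $S\subset M$ put $\underline{\mathcal X}(S)=p'(p^{-1}(S))$. A Lie subgroupoid $R\rightrightarrows L$ of $\Gamma\rightrightarrows M$ is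 a Lie groupoid with injective immersions $R\to\Gamma$, $L\to M$ compatible with all structural maps. A Morita equivalence of Lie subgroupoids $(\mathcal X,\mathcal Y,\mathfrak i)$ between $R\rightrightarrows L$ (in $\Gamma\rightrightarrows M$) and $R'\rightrightarrows L'$ (in $\Gamma'\rightrightarrows M'$) consists of a Morita equivalence $\mathcal X$ between $\Gamma$ and $\Gamma'$, a Morita equivalence $\mathcal Y$ between $R$ and $R'$, and an injective immersion $\mathfrak i:Y\to X$ compatible with the projections $p,p'$ and satisfying $\mathfrak i(r\cdot y\cdot r')=r\cdot\mathfrak i(y)\cdot r'$. Let $\mathcal S\subset M$ be a $\Gamma$-stable embedded submanifold. A Lie subgroupoid $R\rightrightarrows L$ is *in $\mathcal S$* if (a) $L\cap\mathcal S$ is dense in $L$; (b) $T_m\mathcal S=T_mF_m+T_mL$ for all $m\in L\cap\mathcal S$, where $F_m$ is the $\Gamma$-orbit of $m$; (c) $L$ meets every $\Gamma$-orbit contained in $\mathcal S$. A Lie subgroupoid in $\mathcal S$ is *surjective in $\overline{\mathcal S}$* if $L$ meets every $\Gamma$-orbit contained in $\overline{\mathcal S}$; *full in $\mathcal S$* if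 every arrow of $\Gamma$ with source and target in $L\cap\mathcal S$ belongs to $R$; *proper* if for every compact $K\subset\overline{\mathcal S}$ the quotient topological space $R\backslash\Gamma_L^K$ is compact (every open cover has a finite subcover), where $\Gamma_L^K$ is the space of arrows with source in $L$ and target in $K$, topologized as a subspace of $L\times\Gamma$. **Proposition.** Let $(\mathcal X,\mathcal Y,\mathfrak i)$ be a Morita equivalence of Lie subgroupoids between a Lie subgroupoid $R\rightrightarrows L$ of $\Gamma\rightrightarrows M$ and a Lie subgroupoid $R'\rightrightarrows L'$ of $\Gamma'\rightrightarrows M'$. Let $\mathcal S$ be a $\Gamma$-stable embedded submanifold of $M$ and $\mathcal S'=\underline{\mathcal X}(\mathcal S)$. Then $\mathcal S'$ is a $\Gamma'$-stable embedded submanifold of $M'$, and: 1. $R\rightrightarrows L$ is in $\mathcal S$ if and only if $R'\rightrightarrows L'$ is in $\mathcal S'$; 2. $R\rightrightarrows L$ is surjective in $\overline{\mathcal S}$ if and only if $R'\rightrightarrows L'$ is surjective in $\overline{\mathcal S'}$; 3. $R\rightrightarrows L$ is full in $\mathcal S$ if and only if $R'\rightrightarrows L'$ is full in $\mathcal S'$;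 4. $R\rightrightarrows L$ is proper (with respect to $\mathcal S$) if and only if $R'\rightrightarrows L'$ is proper (with respect to $\mathcal S'$). -/

import Mathlib

open Set Filter Topology
open scoped Manifold ContDiff

universe v u w

/-! ### Manifolds -/

/-- A finite-dimensional Hausdorff second countable manifold without boundary over `𝕜`:
a smooth manifold for `𝕜 = ℝ`, a complex manifold for `𝕜 = ℂ` (over `ℂ`, maps of class `C^∞`
are exactly the holomorphic ones). -/
structure Mfd (𝕜 : Type v) [RCLike 𝕜] : Type (max v (u + 1)) where
  carrier : Type u
  dim : ℕ
  [top : TopologicalSpace carrier]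
  [charted : ChartedSpace (EuclideanSpace 𝕜 (Fin dim)) carrier]
  [smooth : IsManifold 𝓘(𝕜, EuclideanSpace 𝕜 (Fin dim)) ∞ carrier]
  [hausdorff : T2Space carrier]
  [secondCountable : SecondCountableTopology carrier]

namespace Mfd

variable {𝕜 : Type v} [RCLike 𝕜]

instance : CoeSort (Mfd.{v, u} 𝕜) (Type u) := ⟨Mfd.carrier⟩

attribute [instance] Mfd.top Mfd.charted Mfd.smooth Mfd.hausdorff Mfd.secondCountable

/-- The model vector space. In Mathlib every tangent space `TangentSpace M.I m` is, by definition,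
this vector space (through the preferred chart at `m`). -/
abbrev E (M : Mfd.{v, u} 𝕜) : Type v := EuclideanSpace 𝕜 (Fin M.dim)

/-- The model with corners (without boundary) of `M`. -/
noncomputable abbrev I (M : Mfd.{v, u} 𝕜) : ModelWithCorners 𝕜 M.E M.E := 𝓘(𝕜, M.E)

/-- `S` is an embedded submanifold of `M`: near each of its points, `S` is the zero set of a
submersion to some `𝕜 ^ k`. -/
def IsEmbeddedSubmanifold (M : Mfd.{v, u} 𝕜) (S : Set M) : Prop :=
  ∀ m ∈ S, ∃ U : Set M, IsOpen U ∧ m ∈ U ∧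
    ∃ (k : ℕ) (f : M → EuclideanSpace 𝕜 (Fin k)),
      ContMDiffOn M.I 𝓘(𝕜, EuclideanSpace 𝕜 (Fin k)) ∞ f U ∧
      (∀ x ∈ U, Function.Surjective (mfderiv M.I 𝓘(𝕜, EuclideanSpace 𝕜 (Fin k)) f x)) ∧
      S ∩ U = {x ∈ U | f x = 0}

/-- The tangent space `T_m S ⊆ T_m M` of an embedded submanifold `S` at `m ∈ S`: the vectors which
are velocities at `0` of smooth (holomorphic) paths in `S` starting at `m`. (These velocities form
a vector space when `S` is an embedded submanifold, so that taking the span adds nothing.) -/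
def tangentOfSubset (M : Mfd.{v, u} 𝕜) (S : Set M) (m : M) : Submodule 𝕜 M.E :=
  Submodule.span 𝕜 {u : M.E | ∃ c : 𝕜 → M,
    c 0 = m ∧ ContMDiffAt 𝓘(𝕜, 𝕜) M.I ∞ c 0 ∧ (∀ᶠ ε in 𝓝 (0 : 𝕜), c ε ∈ S) ∧
      mfderiv 𝓘(𝕜, 𝕜) M.I c 0 (1 : 𝕜) = u}

end Mfd

/-! ### Lie groupoids -/

/-- A Lie groupoid `Γ ⇉ M` (with `Γ = Arr`, `M = Obj`). The product `g * h` is defined when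
`tgt g = src h`; it is encoded by a function `mul` on all pairs, whose values on non-composable
pairs are irrelevant. The set of composable pairs being an embedded submanifold of `Γ × Γ`,
smoothness of the product on it is smoothness `ContMDiffOn` this set. -/
structure LieGroupoid (𝕜 : Type v) [RCLike 𝕜] : Type (max v (u + 1)) where
  Arr : Mfd.{v, u} 𝕜
  Obj : Mfd.{v, u} 𝕜
  src : Arr → Obj
  tgt : Arr → Obj
  unit : Obj → Arr
  mul : Arr → Arr → Arr
  inv : Arr → Arr
  src_unit : ∀ m, src (unit m) = m
  tgt_unit : ∀ m, tgt (unit m) = m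
  src_mul : ∀ g h, tgt g = src h → src (mul g h) = src g
  tgt_mul : ∀ g h, tgt g = src h → tgt (mul g h) = tgt h
  mul_assoc : ∀ g h k, tgt g = src h → tgt h = src k → mul (mul g h) k = mul g (mul h k)
  unit_mul : ∀ g, mul (unit (src g)) g = g
  mul_unit : ∀ g, mul g (unit (tgt g)) = g
  src_inv : ∀ g, src (inv g) = tgt g
  tgt_inv : ∀ g, tgt (inv g) = src g
  mul_inv : ∀ g, mul g (inv g) = unit (src g)
  inv_mul : ∀ g, mul (inv g) g = unit (tgt g)
  submersion_src : Manifold.IsSubmersion Arr.I Obj.I ∞ src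
  submersion_tgt : Manifold.IsSubmersion Arr.I Obj.I ∞ tgt
  smooth_unit : ContMDiff Obj.I Arr.I ∞ unit
  smooth_inv : ContMDiff Arr.I Arr.I ∞ inv
  smooth_mul : ContMDiffOn (Arr.I.prod Arr.I) Arr.I ∞
    (fun q : Arr × Arr => mul q.1 q.2) {q | tgt q.1 = src q.2}

namespace LieGroupoid

variable {𝕜 : Type v} [RCLike 𝕜] (Γ : LieGroupoid.{v, u} 𝕜)

/-- The orbit of `m`. -/
def orbit (m : Γ.Obj) : Set Γ.Obj := {m' | ∃ g : Γ.Arr, Γ.src g = m ∧ Γ.tgt g = m'}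

/-- `Γ`-stable subsets of the unit manifold. -/
def IsStable (S : Set Γ.Obj) : Prop := ∀ g : Γ.Arr, Γ.tgt g ∈ S ↔ Γ.src g ∈ S

/-- The tangent space at `m` of the orbit `F_m` through `m`. The manifold structure of `F_m` is
the one for which `tgt : src⁻¹(m) → F_m` is a submersion, so that `T_m F_m` is the image under the
differential of `tgt` of the tangent space `ker d(src)` of `src⁻¹(m)` at the unit of `m`. -/
noncomputable def orbitTangent (m : Γ.Obj) : Submodule 𝕜 Γ.Obj.E :=
  Submodule.map
    (mfderiv Γ.Arr.I Γ.Obj.I Γ.tgt (Γ.unit m) : Γ.Arr.E →L[𝕜] Γ.Obj.E).toLinearMap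
    (LinearMap.ker
      (mfderiv Γ.Arr.I Γ.Obj.I Γ.src (Γ.unit m) : Γ.Arr.E →L[𝕜] Γ.Obj.E).toLinearMap)

end LieGroupoid

/-! ### Modules and Morita equivalences -/

/-- A left action of `Γ` on `X` with moment map `p`: `γ · x` is defined when `tgt γ = p x`
(the values of `act` on other pairs are irrelevant). -/
structure LeftModule {𝕜 : Type v} [RCLike 𝕜] (Γ : LieGroupoid.{v, u} 𝕜) (X : Mfd.{v, w} 𝕜)
    (p : X → Γ.Obj) where
  act : Γ.Arr → X → X
  moment_act : ∀ g x, Γ.tgt g = p x → p (act g x) = Γ.src g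
  unit_act : ∀ x, act (Γ.unit (p x)) x = x
  mul_act : ∀ g h x, Γ.tgt g = Γ.src h → Γ.tgt h = p x → act (Γ.mul g h) x = act g (act h x)
  smooth_act : ContMDiffOn (Γ.Arr.I.prod X.I) X.I ∞
    (fun q : Γ.Arr × X => act q.1 q.2) {q | Γ.tgt q.1 = p q.2}

/-- A right action of `Γ` on `X` with moment map `p`: `x · γ` is defined when `p x = src γ`
(the values of `act` on other pairs are irrelevant). -/
structure RightModule {𝕜 : Type v} [RCLike 𝕜] (Γ : LieGroupoid.{v, u} 𝕜) (X : Mfd.{v, w} 𝕜)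
    (p : X → Γ.Obj) where
  act : X → Γ.Arr → X
  moment_act : ∀ x g, p x = Γ.src g → p (act x g) = Γ.tgt g
  act_unit : ∀ x, act x (Γ.unit (p x)) = x
  act_mul : ∀ x g h, p x = Γ.src g → Γ.tgt g = Γ.src h → act x (Γ.mul g h) = act (act x g) h
  smooth_act : ContMDiffOn (X.I.prod Γ.Arr.I) X.I ∞
    (fun q : X × Γ.Arr => act q.1 q.2) {q | p q.1 = Γ.src q.2}

/-- A Morita equivalence between `Γ ⇉ M` and `Γ' ⇉ M'`: a manifold `X` with surjective submersions
`p : X → M` and `p' : X → M'`, commuting left `Γ`- and right `Γ'`-actions preserving the fibres of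
`p'` and `p` respectively, both actions being proper, free and transitive on these fibres. -/
structure LieMoritaEquivalence {𝕜 : Type v} [RCLike 𝕜] (Γ Γ' : LieGroupoid.{v, u} 𝕜) :
    Type (max v u (w + 1)) where
  X : Mfd.{v, w} 𝕜
  p : X → Γ.Obj
  p' : X → Γ'.Obj
  submersion_p : Manifold.IsSubmersion X.I Γ.Obj.I ∞ p
  submersion_p' : Manifold.IsSubmersion X.I Γ'.Obj.I ∞ p'
  surjective_p : Function.Surjective p
  surjective_p' : Function.Surjective p'
  left : LeftModule Γ X p
  right : RightModule Γ' X p'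
  p'_left : ∀ g x, Γ.tgt g = p x → p' (left.act g x) = p' x
  p_right : ∀ x g', p' x = Γ'.src g' → p (right.act x g') = p x
  comm : ∀ g x g', Γ.tgt g = p x → p' x = Γ'.src g' →
    right.act (left.act g x) g' = left.act g (right.act x g')
  proper_left : IsProperMap
    (fun q : {q : Γ.Arr × X // Γ.tgt q.1 = p q.2} => (left.act q.1.1 q.1.2, q.1.2))
  proper_right : IsProperMap
    (fun q : {q : X × Γ'.Arr // p' q.1 = Γ'.src q.2} => (q.1.1, right.act q.1.1 q.1.2))
  free_left : ∀ g x, Γ.tgt g = p x → left.act g x = x → g = Γ.unit (p x)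
  free_right : ∀ x g', p' x = Γ'.src g' → right.act x g' = x → g' = Γ'.unit (p' x)
  transitive_left : ∀ x y, p' x = p' y → ∃ g, Γ.tgt g = p x ∧ left.act g x = y
  transitive_right : ∀ x y, p x = p y → ∃ g', p' x = Γ'.src g' ∧ right.act x g' = y

/-- The correspondence `S ↦ p'(p⁻¹(S))` from `Γ`-stable subsets to `Γ'`-stable subsets. -/
def LieMoritaEquivalence.image {𝕜 : Type v} [RCLike 𝕜] {Γ Γ' : LieGroupoid.{v, u} 𝕜}
    (Φ : LieMoritaEquivalence.{v, u, w} Γ Γ') (S : Set Γ.Obj) : Set Γ'.Obj :=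
  Φ.p' '' (Φ.p ⁻¹' S)

/-! ### Lie subgroupoids -/

/-- A Lie subgroupoid `R ⇉ L` of `Γ ⇉ M`: a Lie groupoid `R ⇉ L` with injective immersions
`R → Γ` and `L → M` compatible with all the structural maps. Embedded submanifolds are the case in
which these two maps are moreover topological embeddings. -/
structure LieSubgroupoid {𝕜 : Type v} [RCLike 𝕜] (Γ : LieGroupoid.{v, u} 𝕜) :
    Type (max v (u + 1)) where
  gpd : LieGroupoid.{v, u} 𝕜
  inclArr : gpd.Arr → Γ.Arr
  inclObj : gpd.Obj → Γ.Obj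
  immersion_arr : Manifold.IsImmersion gpd.Arr.I Γ.Arr.I ∞ inclArr
  immersion_obj : Manifold.IsImmersion gpd.Obj.I Γ.Obj.I ∞ inclObj
  injective_arr : Function.Injective inclArr
  injective_obj : Function.Injective inclObj
  src_incl : ∀ r, Γ.src (inclArr r) = inclObj (gpd.src r)
  tgt_incl : ∀ r, Γ.tgt (inclArr r) = inclObj (gpd.tgt r)
  unit_incl : ∀ l, inclArr (gpd.unit l) = Γ.unit (inclObj l)
  mul_incl : ∀ r₁ r₂, gpd.tgt r₁ = gpd.src r₂ →
    inclArr (gpd.mul r₁ r₂) = Γ.mul (inclArr r₁) (inclArr r₂)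
  inv_incl : ∀ r, inclArr (gpd.inv r) = Γ.inv (inclArr r)

namespace LieSubgroupoid

variable {𝕜 : Type v} [RCLike 𝕜] {Γ : LieGroupoid.{v, u} 𝕜} (R : LieSubgroupoid Γ)

/-- `L` intersects transversally the `Γ`-orbits contained in `S`:
`T_m S = T_m F_m + T_m L` for all `m ∈ L ∩ S`. -/
def IsTransverse (S : Set Γ.Obj) : Prop :=
  ∀ l : R.gpd.Obj, R.inclObj l ∈ S →
    Γ.Obj.tangentOfSubset S (R.inclObj l) =
      Γ.orbitTangent (R.inclObj l) ⊔
        LinearMap.range (mfderiv R.gpd.Obj.I Γ.Obj.I R.inclObj l :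
          R.gpd.Obj.E →L[𝕜] Γ.Obj.E).toLinearMap

/-- `L` meets every `Γ`-orbit contained in `T`. -/
def MeetsOrbits (T : Set Γ.Obj) : Prop :=
  ∀ m : Γ.Obj, Γ.orbit m ⊆ T → (range R.inclObj ∩ Γ.orbit m).Nonempty

/-- `R ⇉ L` is a Lie subgroupoid in `S`. -/
structure IsIn (S : Set Γ.Obj) : Prop where
  dense : Dense (R.inclObj ⁻¹' S)
  transverse : R.IsTransverse S
  meets : R.MeetsOrbits S

/-- `R ⇉ L` is a Lie subgroupoid in `S` which is surjective in the closure of `S`. -/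
structure IsSurjectiveIn (S : Set Γ.Obj) : Prop where
  isIn : R.IsIn S
  meets_closure : R.MeetsOrbits (closure S)

/-- `R ⇉ L` is a Lie subgroupoid in `S` which is full in `S`: the arrows of `R` and the arrows
of `Γ` with source and target in `L ∩ S` are the same. -/
structure IsFullIn (S : Set Γ.Obj) : Prop where
  isIn : R.IsIn S
  full : {g : Γ.Arr | g ∈ range R.inclArr ∧
        Γ.src g ∈ range R.inclObj ∩ S ∧ Γ.tgt g ∈ range R.inclObj ∩ S} =
      {g : Γ.Arr | Γ.src g ∈ range R.inclObj ∩ S ∧ Γ.tgt g ∈ range R.inclObj ∩ S}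

/-- The space `Γ_L^K` of arrows with source in `L` and target in `K`, as a subspace of `L × Γ`
(when `L` is embedded, this is the subspace `src⁻¹(L) ∩ tgt⁻¹(K)` of `Γ`). -/
abbrev ArrowsTo (K : Set Γ.Obj) :=
  {q : R.gpd.Obj × Γ.Arr // R.inclObj q.1 = Γ.src q.2 ∧ Γ.tgt q.2 ∈ K}

/-- Two elements of `Γ_L^K` are related when the second is `r · γ`, where `γ` is the first. -/
def actRel (K : Set Γ.Obj) (a b : R.ArrowsTo K) : Prop :=
  ∃ r : R.gpd.Arr, R.gpd.tgt r = a.1.1 ∧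
    b.1 = (R.gpd.src r, Γ.mul (R.inclArr r) a.1.2)

/-- `R ⇉ L` is a Lie subgroupoid in `S` which is proper: for every compact subset `K` of the
closure of `S`, the quotient topological space `R \ Γ_L^K` is compact. -/
structure IsProperIn (S : Set Γ.Obj) : Prop where
  isIn : R.IsIn S
  compact : ∀ K : Set Γ.Obj, IsCompact K → K ⊆ closure S → CompactSpace (Quot (R.actRel K))

end LieSubgroupoid

/-- A Morita equivalence `(X, Y, i)` between a Lie subgroupoid `R ⇉ L` of `Γ ⇉ M` and a Lie
subgroupoid `R' ⇉ L'` of `Γ' ⇉ M'`. -/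
structure SubgroupoidMoritaEquivalence {𝕜 : Type v} [RCLike 𝕜] {Γ Γ' : LieGroupoid.{v, u} 𝕜}
    (R : LieSubgroupoid Γ) (R' : LieSubgroupoid Γ') : Type (max v u (w + 1)) where
  X : LieMoritaEquivalence.{v, u, w} Γ Γ'
  Y : LieMoritaEquivalence.{v, u, w} R.gpd R'.gpd
  i : Y.X → X.X
  immersion_i : Manifold.IsImmersion Y.X.I X.X.I ∞ i
  injective_i : Function.Injective i
  p_i : ∀ y, X.p (i y) = R.inclObj (Y.p y)
  p'_i : ∀ y, X.p' (i y) = R'.inclObj (Y.p' y)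
  equivariant : ∀ r y r', R.gpd.tgt r = Y.p y → Y.p' y = R'.gpd.src r' →
    i (Y.right.act (Y.left.act r y) r') =
      X.right.act (X.left.act (R.inclArr r) (i y)) (R'.inclArr r')

/-! Everything is compared upstairs, on the bibundle `X`. For a stable `S`, transitivity on the
fibres of `p'` gives `p'⁻¹(image S) = p⁻¹(S)` (`preimage_image`), and a condition on `R` in `S` is
turned into one on `X` and `Y` in which `p` and `p'` play the same role. Both projections are open
surjections, so closures, density and orbits pass through them. The inverse equivalence `symm` makes
one implication of each statement enough.

The analytic point is transversality. Pulled back by `dp`, the equation `TS = TF + TL` becomes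
`T(p⁻¹S) = ker dp + ker dp' + TY`, which is symmetric (`isTransverse_iff`). This needs `TF = dp(ker
dp')` (`orbitTangent_eq`), that is, that `γ ↦ γ · x` is a submersion from a fibre of `tgt` onto a
fibre of `p'`. The action provides a continuous local inverse: it exists by freeness and
transitivity, and properness makes it continuous. Equivariance makes the kernel of the differential
locally minimal at the unit (`eventually_finrank_ker_le_of_equivariant`), hence the rank locally
constant. A constant rank map with a continuous local right inverse cannot have a deficient
differential (`surjective_fderiv_of_finrank_ker_le`).

Fullness is a transfer of arrows through `i(y₁) · g' = g · i(y₂)`. For properness, a compact `K'` is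
written `p'(C)` with `C ⊆ X` compact, and `R' \ Γ'_{L'}^{K'}` is a continuous image of the compact
fibre product of `R \ Γ_L^{p(C)}` and `C` over `M` (`compactSpace_quot_image`). -/

namespace Mfd

/-! ### Local product charts of submersions -/

variable {𝕜 : Type v} [RCLike 𝕜]

/-- A local product decomposition of `X` near `x`, in which `f` is the first projection. -/
structure SubmersionChart {X : Mfd.{v, w} 𝕜} {N : Mfd.{v, u} 𝕜} (f : X → N) (x : X) where
  F : Type v
  [normed : NormedAddCommGroup F]
  [space : NormedSpace 𝕜 F]
  [finite : FiniteDimensional 𝕜 F]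
  e : OpenPartialHomeomorph X (N × F)
  mem_source : x ∈ e.source
  contMDiffOn : ContMDiffOn X.I (N.I.prod 𝓘(𝕜, F)) ∞ e e.source
  contMDiffOn_symm : ContMDiffOn (N.I.prod 𝓘(𝕜, F)) X.I ∞ e.symm e.target
  fst_eq : ∀ z ∈ e.source, (e z).1 = f z

attribute [instance] SubmersionChart.normed SubmersionChart.space SubmersionChart.finite

/-- The normal form of a submersion is a linear projection in charts of both sides; undoing the
chart of `N` on the first factor makes the first component `f` itself. -/
theorem nonempty_submersionChart {X : Mfd.{v, w} 𝕜} {N : Mfd.{v, u} 𝕜} {f : X → N}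
    (hf : Manifold.IsSubmersion X.I N.I ∞ f) (x : X) : Nonempty (SubmersionChart f x) := by
  obtain ⟨F, i₁, i₂, h⟩ := hf.isSubmersionAt x
  have hfin : FiniteDimensional 𝕜 F :=
    Module.Finite.of_surjective
      ((LinearMap.snd 𝕜 N.E F).comp h.equiv.toLinearEquiv.toLinearMap)
      ((LinearMap.snd_surjective (R := 𝕜) (M := N.E) (M₂ := F)).comp h.equiv.surjective)
  let e : OpenPartialHomeomorph X (N × F) :=
    (h.domChart ≫ₕ h.equiv.toHomeomorph.toOpenPartialHomeomorph) ≫ₕ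
      (h.codChart.symm.prod (OpenPartialHomeomorph.refl F))
  have key : ∀ z ∈ h.domChart.source, (h.equiv (h.domChart z)).1 = h.codChart (f z) := by
    intro z hz
    have hmem : h.domChart z ∈ (h.domChart.extend X.I).target := by
      simpa using h.domChart.map_source hz
    have := h.writtenInCharts hmem
    simpa [h.domChart.left_inv hz] using this.symm
  have hsrc : ∀ z, z ∈ e.source ↔ z ∈ h.domChart.source := by
    intro z
    simp only [e, OpenPartialHomeomorph.trans_source, mem_inter_iff, mem_preimage,
      OpenPartialHomeomorph.prod_source, mem_prod]
    refine ⟨fun hz => hz.1.1, fun hz => ⟨⟨hz, trivial⟩, ?_, trivial⟩⟩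
    have := h.codChart.map_source (h.source_subset_preimage_source hz)
    rw [← key z hz] at this
    exact this
  refine ⟨⟨F, e, (hsrc x).2 h.mem_domChart_source, ?_, ?_, ?_⟩⟩
  · have h1 : ContMDiffOn X.I 𝓘(𝕜, X.E) ∞ h.domChart h.domChart.source :=
      contMDiffOn_of_mem_maximalAtlas h.domChart_mem_maximalAtlas
    have h2 : ContMDiffOn 𝓘(𝕜, N.E) N.I ∞ h.codChart.symm h.codChart.target :=
      contMDiffOn_symm_of_mem_maximalAtlas h.codChart_mem_maximalAtlas
    have h3 : ContMDiffOn X.I 𝓘(𝕜, N.E) ∞ (fun z => (h.equiv (h.domChart z)).1) e.source :=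
      ((contDiff_fst.comp h.equiv.contDiff).contMDiff.contMDiffOn (s := univ)).comp
        (h1.mono fun z hz => (hsrc z).1 hz) fun _ _ => trivial
    have h4 : ContMDiffOn X.I 𝓘(𝕜, F) ∞ (fun z => (h.equiv (h.domChart z)).2) e.source :=
      ((contDiff_snd.comp h.equiv.contDiff).contMDiff.contMDiffOn (s := univ)).comp
        (h1.mono fun z hz => (hsrc z).1 hz) fun _ _ => trivial
    exact (h2.comp h3 fun z hz => hz.2.1).prodMk h4
  · have h1 : ContMDiffOn 𝓘(𝕜, X.E) X.I ∞ h.domChart.symm h.domChart.target :=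
      contMDiffOn_symm_of_mem_maximalAtlas h.domChart_mem_maximalAtlas
    have h2 : ContMDiffOn N.I 𝓘(𝕜, N.E) ∞ h.codChart h.codChart.source :=
      contMDiffOn_of_mem_maximalAtlas h.codChart_mem_maximalAtlas
    have h3 : ContMDiffOn (N.I.prod 𝓘(𝕜, F)) 𝓘(𝕜, N.E × F) ∞
        (fun q : N × F => (h.codChart q.1, q.2)) e.target :=
      (h2.comp (contMDiff_fst.contMDiffOn (s := e.target))
        fun q hq => hq.1.1).prodMk_space contMDiff_snd.contMDiffOn
    have h4 := (h.equiv.symm.contDiff (n := ∞)).contMDiff.comp_contMDiffOn h3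
    exact h1.comp h4 fun q hq => by simpa using hq.2.2
  · intro z hz
    have hz' := (hsrc z).1 hz
    change h.codChart.symm (h.equiv (h.domChart z)).1 = f z
    rw [key z hz', h.codChart.left_inv (h.source_subset_preimage_source hz')]

namespace SubmersionChart

variable {X : Mfd.{v, w} 𝕜} {N : Mfd.{v, u} 𝕜} {f : X → N} {x : X} (c : SubmersionChart f x)

/-- The fibre coordinate of a submersion chart. -/
def coord (z : X) : c.F := (c.e z).2

/-- The parametrization of the fibre through `x`. -/
noncomputable def fib (b : c.F) : X := c.e.symm (f x, b)

theorem e_eq {z : X} (hz : z ∈ c.e.source) : c.e z = (f z, c.coord z) :=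
  Prod.ext (c.fst_eq z hz) rfl

theorem base_mem_target : (f x, c.coord x) ∈ c.e.target := by
  rw [← c.e_eq c.mem_source]; exact c.e.map_source c.mem_source

theorem symm_base : c.e.symm (f x, c.coord x) = x := by
  rw [← c.e_eq c.mem_source, c.e.left_inv c.mem_source]

theorem fib_coord : c.fib (c.coord x) = x := c.symm_base

theorem f_symm {q : N × c.F} (hq : q ∈ c.e.target) : f (c.e.symm q) = q.1 := by
  rw [← c.fst_eq _ (c.e.map_target hq), c.e.right_inv hq]

theorem coord_symm {q : N × c.F} (hq : q ∈ c.e.target) : c.coord (c.e.symm q) = q.2 := by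
  rw [coord, c.e.right_inv hq]

theorem symm_eq {z : X} (hz : z ∈ c.e.source) : c.e.symm (f z, c.coord z) = z := by
  rw [← c.e_eq hz, c.e.left_inv hz]

theorem fib_coord_of_mem {z : X} (hz : z ∈ c.e.source) (h : f z = f x) :
    c.fib (c.coord z) = z := by
  have := c.symm_eq hz
  rwa [h] at this

theorem source_mem_nhds : c.e.source ∈ 𝓝 x := c.e.open_source.mem_nhds c.mem_source

theorem target_mem_nhds : c.e.target ∈ 𝓝 (f x, c.coord x) :=
  c.e.open_target.mem_nhds c.base_mem_target

theorem contMDiffAt_coord : ContMDiffAt X.I 𝓘(𝕜, c.F) ∞ c.coord x :=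
  contMDiffAt_snd.comp x (c.contMDiffOn.contMDiffAt c.source_mem_nhds)

theorem contMDiffAt_symm : ContMDiffAt (N.I.prod 𝓘(𝕜, c.F)) X.I ∞ c.e.symm (f x, c.coord x) :=
  c.contMDiffOn_symm.contMDiffAt c.target_mem_nhds

theorem contMDiffAt_fib : ContMDiffAt 𝓘(𝕜, c.F) X.I ∞ c.fib (c.coord x) :=
  ContMDiffAt.comp (c.coord x) (g := c.e.symm) (f := fun b : c.F => (f x, b)) c.contMDiffAt_symm
    (contMDiffAt_const.prodMk contMDiffAt_id)

theorem eventually_fib_mem : ∀ᶠ b in 𝓝 (c.coord x), (f x, b) ∈ c.e.target :=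
  (Continuous.prodMk_right (f x)).continuousAt.eventually_mem c.target_mem_nhds

theorem eventually_sec_mem : ∀ᶠ n in 𝓝 (f x), (n, c.coord x) ∈ c.e.target :=
  (Continuous.prodMk_left (c.coord x)).continuousAt.eventually_mem c.target_mem_nhds

/-- The local section of `f` through `x`. -/
noncomputable def sec (n : N) : X := c.e.symm (n, c.coord x)

theorem sec_base : c.sec (f x) = x := c.symm_base

theorem contMDiffAt_sec : ContMDiffAt N.I X.I ∞ c.sec (f x) :=
  ContMDiffAt.comp (f x) (g := c.e.symm) (f := fun n : N => (n, c.coord x)) c.contMDiffAt_symm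
    (contMDiffAt_id.prodMk contMDiffAt_const)

theorem eventually_f_sec : ∀ᶠ n in 𝓝 (f x), f (c.sec n) = n :=
  c.eventually_sec_mem.mono fun _ hn => c.f_symm hn

theorem eventually_f_fib : ∀ᶠ b in 𝓝 (c.coord x), f (c.fib b) = f x :=
  c.eventually_fib_mem.mono fun _ hb => c.f_symm hb

theorem eventually_coord_fib : ∀ᶠ b in 𝓝 (c.coord x), c.coord (c.fib b) = b :=
  c.eventually_fib_mem.mono fun _ hb => c.coord_symm hb

end SubmersionChart

end Mfd

/-! ### Differentials between model spaces, with types independent of the base point -/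

section ModelDerivative

variable {𝕜 : Type*} [NontriviallyNormedField 𝕜]
  {E : Type*} [NormedAddCommGroup E] [NormedSpace 𝕜 E] {H : Type*} [TopologicalSpace H]
  {E' : Type*} [NormedAddCommGroup E'] [NormedSpace 𝕜 E'] {H' : Type*} [TopologicalSpace H']
  {E'' : Type*} [NormedAddCommGroup E''] [NormedSpace 𝕜 E''] {H'' : Type*} [TopologicalSpace H'']
  (I : ModelWithCorners 𝕜 E H) (J : ModelWithCorners 𝕜 E' H') (K : ModelWithCorners 𝕜 E'' H'')
  {M : Type*} [TopologicalSpace M] [ChartedSpace H M]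
  {N : Type*} [TopologicalSpace N] [ChartedSpace H' N]
  {P : Type*} [TopologicalSpace P] [ChartedSpace H'' P]

/-- The manifold derivative, as a map between the model vector spaces. -/
noncomputable def modelDeriv (f : M → N) (x : M) : E →L[𝕜] E' := mfderiv I J f x

/-- `HasMFDerivAt` for a derivative given as a map between the model vector spaces. -/
def HasModelDerivAt (f : M → N) (x : M) (f' : E →L[𝕜] E') : Prop := HasMFDerivAt I J f x f'

variable {I J K}

theorem ContMDiffAt.hasModelDerivAt {f : M → N} {x : M} (hf : ContMDiffAt I J ∞ f x) :
    HasModelDerivAt I J f x (modelDeriv I J f x) :=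
  (hf.mdifferentiableAt (by simp)).hasMFDerivAt

namespace HasModelDerivAt

variable {f : M → N} {x : M} {f' f₁' : E →L[𝕜] E'} {g : N → P} {g' : E' →L[𝕜] E''}

theorem unique (h : HasModelDerivAt I J f x f') (h₁ : HasModelDerivAt I J f x f₁') : f' = f₁' :=
  hasMFDerivAt_unique h h₁

theorem modelDeriv_eq (h : HasModelDerivAt I J f x f') : modelDeriv I J f x = f' :=
  HasMFDerivAt.mfderiv h

theorem congr {f₁ : M → N} (h : HasModelDerivAt I J f x f') (h₁ : f₁ =ᶠ[𝓝 x] f) :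
    HasModelDerivAt I J f₁ x f' := HasMFDerivAt.congr_of_eventuallyEq h h₁

/-- Keeping `y` apart from `f x` allows identities between base points that hold only
propositionally, such as `c.sec_base`. -/
theorem comp {y : N} (hg : HasModelDerivAt J K g y g') (hf : HasModelDerivAt I J f x f')
    (hy : f x = y) : HasModelDerivAt I K (fun z => g (f z)) x (g'.comp f') := by
  subst hy; exact HasMFDerivAt.comp x hg hf

theorem prodMk {h : M → P} {h' : E →L[𝕜] E''} (hf : HasModelDerivAt I J f x f')
    (hh : HasModelDerivAt I K h x h') :
    HasModelDerivAt I (J.prod K) (fun z => (f z, h z)) x (f'.prod h') := HasMFDerivAt.prodMk hf hh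

theorem id (x : M) : HasModelDerivAt I I (fun z : M => z) x (ContinuousLinearMap.id 𝕜 E) :=
  hasMFDerivAt_id x

theorem const (y : N) (x : M) : HasModelDerivAt I J (fun _ : M => y) x 0 :=
  hasMFDerivAt_const y x

end HasModelDerivAt

end ModelDerivative

/-! ### Differentials and openness of submersions -/

namespace Mfd

variable {𝕜 : Type v} [RCLike 𝕜]

namespace SubmersionChart

variable {X : Mfd.{v, w} 𝕜} {N : Mfd.{v, u} 𝕜} {f : X → N} {x : X} (c : SubmersionChart f x)

theorem contMDiffAt (c : SubmersionChart f x) : ContMDiffAt X.I N.I ∞ f x := by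
  have h := contMDiffAt_fst.comp x (c.contMDiffOn.contMDiffAt c.source_mem_nhds)
  refine h.congr_of_eventuallyEq ?_
  filter_upwards [c.source_mem_nhds] with z hz using (c.fst_eq z hz).symm

/-- The differential of the section `sec`. -/
noncomputable def dSec : N.E →L[𝕜] X.E := modelDeriv N.I X.I c.sec (f x)

/-- The differential of the parametrization `fib` of the fibre. -/
noncomputable def dFib : c.F →L[𝕜] X.E := modelDeriv 𝓘(𝕜, c.F) X.I c.fib (c.coord x)

/-- The differential of the fibre coordinate. -/
noncomputable def dCoord : X.E →L[𝕜] c.F := modelDeriv X.I 𝓘(𝕜, c.F) c.coord x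

theorem hasModelDerivAt_sec : HasModelDerivAt N.I X.I c.sec (f x) c.dSec :=
  c.contMDiffAt_sec.hasModelDerivAt

theorem hasModelDerivAt_fib : HasModelDerivAt 𝓘(𝕜, c.F) X.I c.fib (c.coord x) c.dFib :=
  c.contMDiffAt_fib.hasModelDerivAt

theorem hasModelDerivAt_coord : HasModelDerivAt X.I 𝓘(𝕜, c.F) c.coord x c.dCoord :=
  c.contMDiffAt_coord.hasModelDerivAt

theorem hasModelDerivAt (c : SubmersionChart f x) : HasModelDerivAt X.I N.I f x (modelDeriv X.I N.I f x) :=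
  c.contMDiffAt.hasModelDerivAt

/-- Differentiate `e.symm (f z, coord z) = z` and split the differential of `e.symm` along the two
factors. -/
theorem dSec_add_dFib (v : X.E) : c.dSec (modelDeriv X.I N.I f x v) + c.dFib (c.dCoord v) = v := by
  have hA := c.contMDiffAt_symm.hasModelDerivAt
  set A := modelDeriv (N.I.prod 𝓘(𝕜, c.F)) X.I c.e.symm (f x, c.coord x) with hAdef
  have h1 := (hA.comp (c.hasModelDerivAt.prodMk c.hasModelDerivAt_coord) rfl).unique
    ((HasModelDerivAt.id x).congr (by
      filter_upwards [c.source_mem_nhds] with z hz using c.symm_eq hz))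
  have h2 := (hA.comp ((HasModelDerivAt.id (I := N.I) (f x)).prodMk
    (HasModelDerivAt.const (J := 𝓘(𝕜, c.F)) (c.coord x) (f x))) rfl).modelDeriv_eq
  have h3 := (hA.comp ((HasModelDerivAt.const (J := N.I) (f x) (c.coord x)).prodMk
    (HasModelDerivAt.id (I := 𝓘(𝕜, c.F)) (c.coord x))) rfl).modelDeriv_eq
  have h4 := congrArg (fun L : X.E →L[𝕜] X.E => L v) h1
  change c.dSec = _ at h2
  change c.dFib = _ at h3
  rw [h2, h3]
  simp only [ContinuousLinearMap.comp_apply] at h4 ⊢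
  rw [← map_add]
  simpa using h4

theorem f_dSec (v : N.E) : modelDeriv X.I N.I f x (c.dSec v) = v :=
  congrArg (fun L : N.E →L[𝕜] N.E => L v)
    ((c.hasModelDerivAt.comp c.hasModelDerivAt_sec c.sec_base).unique
      ((HasModelDerivAt.id (f x)).congr c.eventually_f_sec))

theorem f_dFib (b : c.F) : modelDeriv X.I N.I f x (c.dFib b) = 0 :=
  congrArg (fun L : c.F →L[𝕜] N.E => L b)
    ((c.hasModelDerivAt.comp c.hasModelDerivAt_fib c.fib_coord).unique
      ((HasModelDerivAt.const (f x) (c.coord x)).congr c.eventually_f_fib))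

theorem dCoord_dFib (b : c.F) : c.dCoord (c.dFib b) = b :=
  congrArg (fun L : c.F →L[𝕜] c.F => L b)
    ((c.hasModelDerivAt_coord.comp c.hasModelDerivAt_fib c.fib_coord).unique
      ((HasModelDerivAt.id (c.coord x)).congr c.eventually_coord_fib))

theorem dFib_dCoord {v : X.E} (hv : modelDeriv X.I N.I f x v = 0) : c.dFib (c.dCoord v) = v := by
  simpa [hv] using c.dSec_add_dFib v

end SubmersionChart

variable {X : Mfd.{v, w} 𝕜} {N : Mfd.{v, u} 𝕜} {f : X → N}

theorem IsSubmersion.surjective_modelDeriv (hf : Manifold.IsSubmersion X.I N.I ∞ f) (x : X) :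
    Function.Surjective (modelDeriv X.I N.I f x) := by
  obtain ⟨c⟩ := nonempty_submersionChart hf x
  exact fun v => ⟨_, c.f_dSec v⟩

/-- Through every point there passes a continuous local section. -/
theorem IsSubmersion.isOpenMap (hf : Manifold.IsSubmersion X.I N.I ∞ f) : IsOpenMap f := by
  rw [isOpenMap_iff_nhds_le]
  intro x
  obtain ⟨c⟩ := nonempty_submersionChart hf x
  have h : Tendsto c.sec (𝓝 (f x)) (𝓝 x) := by
    have := c.contMDiffAt_sec.continuousAt
    rwa [ContinuousAt, c.sec_base] at this
  calc 𝓝 (f x) = map (fun n => f (c.sec n)) (𝓝 (f x)) := by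
        rw [map_congr c.eventually_f_sec, Filter.map_id']
    _ = map f (map c.sec (𝓝 (f x))) := rfl
    _ ≤ map f (𝓝 x) := map_mono h

/-- Composing with a fixed right inverse `s` of `L₀` reduces to endomorphisms of the
finite-dimensional `F`, where surjectivity is injectivity, an open condition. -/
theorem _root_.ContinuousLinearMap.isOpen_surjective {E F : Type*} [NormedAddCommGroup E]
    [NormedSpace 𝕜 E] [NormedAddCommGroup F] [NormedSpace 𝕜 F] [FiniteDimensional 𝕜 F] :
    IsOpen {L : E →L[𝕜] F | Function.Surjective L} := by
  rw [isOpen_iff_mem_nhds]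
  intro L₀ hL₀
  obtain ⟨s, hs⟩ := L₀.toLinearMap.exists_rightInverse_of_surjective
    (LinearMap.range_eq_top.2 hL₀)
  have hc : Continuous fun L : E →L[𝕜] F => L.comp s.toContinuousLinearMap := by fun_prop
  have h₀ : Function.Injective (L₀.comp s.toContinuousLinearMap) := fun a b hab => by
    have h (a : F) : L₀ (s a) = a := congrArg (fun l : F →ₗ[𝕜] F => l a) hs
    simpa [h] using hab
  filter_upwards [hc.continuousAt.eventually_mem
    (ContinuousLinearMap.isOpen_injective.mem_nhds h₀)] with L hL
  have hL' : Function.Injective ((L.comp s.toContinuousLinearMap : F →L[𝕜] F) : F →ₗ[𝕜] F) := hL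
  exact fun b => (LinearMap.injective_iff_surjective.1 hL' b).imp' _ fun _ h => h

/-- The surjectivity of the differential is an open condition. -/
theorem eventually_surjective_modelDeriv {F : Type*} [NormedAddCommGroup F] [NormedSpace 𝕜 F]
    [FiniteDimensional 𝕜 F] {g : N → F} {U : Set N} (hU : IsOpen U)
    (hg : ContMDiffOn N.I 𝓘(𝕜, F) ∞ g U) {m : N} (hm : m ∈ U)
    (hs : Function.Surjective (modelDeriv N.I 𝓘(𝕜, F) g m)) :
    ∀ᶠ n in 𝓝 m, Function.Surjective (modelDeriv N.I 𝓘(𝕜, F) g n) := by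
  set φ := extChartAt N.I m with hφ
  have hsymm : ContMDiffOn 𝓘(𝕜, N.E) N.I ∞ φ.symm φ.target := contMDiffOn_extChartAt_symm m
  have hφm : φ.symm (φ m) = m := extChartAt_to_inv m
  have hsrc : φ.source ∈ 𝓝 m := extChartAt_source_mem_nhds m
  have htgt : IsOpen φ.target := isOpen_extChartAt_target m
  have hG : ContMDiffAt 𝓘(𝕜, N.E) 𝓘(𝕜, F) ∞ (fun z => g (φ.symm z)) (φ m) := by
    refine ContMDiffAt.comp (φ m) (g := g) ?_
      (hsymm.contMDiffAt (htgt.mem_nhds (mem_extChartAt_target m)))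
    rw [hφm]
    exact hg.contMDiffAt (hU.mem_nhds hm)
  have hfd : ContinuousAt (modelDeriv 𝓘(𝕜, N.E) 𝓘(𝕜, F) (fun z => g (φ.symm z))) (φ m) := by
    have : modelDeriv 𝓘(𝕜, N.E) 𝓘(𝕜, F) (fun z => g (φ.symm z)) =
        fderiv 𝕜 (fun z => g (φ.symm z)) := by
      ext1 z; exact mfderiv_eq_fderiv
    rw [this]
    exact hG.contDiffAt.continuousAt_fderiv (by simp)
  have h₀ : Function.Surjective (modelDeriv 𝓘(𝕜, N.E) 𝓘(𝕜, F) (fun z => g (φ.symm z)) (φ m)) := by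
    have h := hG.hasModelDerivAt.comp
      (contMDiffAt_extChartAt (I := N.I) (n := ∞) (x := m)).hasModelDerivAt rfl
    have h' := (h.congr (f₁ := g) (by
      filter_upwards [hsrc] with z hz
      rw [φ.left_inv hz])).modelDeriv_eq
    rw [h'] at hs
    exact Function.Surjective.of_comp hs
  have h₁ := (continuousAt_extChartAt (I := N.I) m).eventually
    (hfd.eventually_mem (ContinuousLinearMap.isOpen_surjective.mem_nhds h₀))
  filter_upwards [h₁, hsrc, hU.mem_nhds hm] with n hn hns hnU
  have hd := (hg.contMDiffAt (hU.mem_nhds hnU)).hasModelDerivAt.comp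
    ((hsymm.contMDiffAt (htgt.mem_nhds (φ.map_source hns))).hasModelDerivAt) (φ.left_inv hns)
  have hn' : Function.Surjective _ := hn
  rw [hd.modelDeriv_eq] at hn'
  exact Function.Surjective.of_comp hn'

end Mfd

/-! ### Constant rank and continuous right inverses -/

section ConstantRank

variable {𝕜 : Type*} [RCLike 𝕜] {E : Type*} [NormedAddCommGroup E] [NormedSpace 𝕜 E]
  [FiniteDimensional 𝕜 E] {V : Type*} [NormedAddCommGroup V] [NormedSpace 𝕜 V]

theorem constant_on_ball_of_hasFDerivAt_zero {W : Type*} [NormedAddCommGroup W] [NormedSpace 𝕜 W]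
    {h : W → V} {k : W} {r : ℝ} (hd : ∀ z ∈ Metric.ball k r, HasFDerivAt h (0 : W →L[𝕜] V) z)
    {z : W} (hz : z ∈ Metric.ball k r) : h z = h k := by
  -- The convexity of the ball is a real notion, also when `𝕜 = ℂ`.
  let _ : NormedSpace ℝ W := NormedSpace.restrictScalars ℝ 𝕜 W
  have hr : 0 < r := dist_nonneg.trans_lt hz
  refine (convex_ball k r).is_const_of_fderivWithin_eq_zero (𝕜 := 𝕜)
    (fun y hy => (hd y hy).differentiableAt.differentiableWithinAt) (fun y hy => ?_) hz
    (Metric.mem_ball_self hr)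
  rw [fderivWithin_of_isOpen Metric.isOpen_ball hy, (hd y hy).fderiv]

variable [FiniteDimensional 𝕜 V]

/-- A map whose differential has kernel of locally minimal dimension at `a`, and which has a local
right inverse continuous at `f a`, is a submersion at `a`. -/
theorem surjective_fderiv_of_finrank_ker_le {f : E → V} {a : E} (hf : ContDiffAt 𝕜 ∞ f a)
    (hker : ∀ᶠ u in 𝓝 a, Module.finrank 𝕜 (LinearMap.ker (fderiv 𝕜 f a).toLinearMap) ≤
      Module.finrank 𝕜 (LinearMap.ker (fderiv 𝕜 f u).toLinearMap))
    {g : V → E} (hg : Tendsto g (𝓝 (f a)) (𝓝 a)) (hfg : ∀ᶠ y in 𝓝 (f a), f (g y) = y) :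
    Function.Surjective (fderiv 𝕜 f a) := by
  have : CompleteSpace E := FiniteDimensional.complete 𝕜 E
  set A : E →ₗ[𝕜] V := (fderiv 𝕜 f a).toLinearMap with hA
  set R := LinearMap.range A
  set K := LinearMap.ker A
  -- Linear projections onto the range and the kernel of the differential at `a`; together they make
  -- `H` a local diffeomorphism.
  obtain ⟨π₀, hπ₀⟩ := R.subtype.exists_leftInverse_of_injective R.ker_subtype
  obtain ⟨P₀, hP₀⟩ := K.subtype.exists_leftInverse_of_injective K.ker_subtype
  have hπ (r : R) : π₀ r = r := congrArg (fun l : R →ₗ[𝕜] R => l r) hπ₀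
  have hP (r : K) : P₀ r = r := congrArg (fun l : K →ₗ[𝕜] K => l r) hP₀
  set π : V →L[𝕜] R := π₀.toContinuousLinearMap
  set P : E →L[𝕜] K := P₀.toContinuousLinearMap
  have hπA : ∀ u, (π (A u) : V) = A u := fun u => congrArg Subtype.val (hπ ⟨A u, u, rfl⟩)
  have hfa : HasFDerivAt f (fderiv 𝕜 f a) a := (hf.differentiableAt (by simp)).hasFDerivAt
  -- the straightening map
  let H : E → R × K := fun u => (π (f u), P u)
  have hH : ContDiffAt 𝕜 ∞ H a :=
    (π.contDiff.contDiffAt.comp a hf).prodMk P.contDiff.contDiffAt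
  have hH' : HasFDerivAt H ((π.comp (fderiv 𝕜 f a)).prod P) a :=
    (π.hasFDerivAt.comp a hfa).prodMk P.hasFDerivAt
  have hinj : Function.Injective ((π.comp (fderiv 𝕜 f a)).prod P).toLinearMap := by
    rw [← LinearMap.ker_eq_bot, LinearMap.ker_eq_bot']
    intro u hu
    have h1 : π (A u) = 0 := congrArg Prod.fst hu
    have h2 : P u = 0 := congrArg Prod.snd hu
    have h3 : A u = 0 := by rw [← hπA, h1]; rfl
    have h4 := hP ⟨u, h3⟩
    have h5 : P₀ u = 0 := h2
    rw [h5] at h4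
    exact (congrArg Subtype.val h4).symm
  have hrank : Module.finrank 𝕜 E = Module.finrank 𝕜 (R × K) := by
    rw [Module.finrank_prod, LinearMap.finrank_range_add_finrank_ker]
  let e : E ≃L[𝕜] R × K :=
    (LinearEquiv.ofInjectiveOfFinrankEq _ hinj hrank).toContinuousLinearEquiv
  have he : HasFDerivAt H (e : E →L[𝕜] R × K) a := hH'
  let Φ := hH.toOpenPartialHomeomorph H he (by simp)
  have hΦa : a ∈ Φ.source := hH.mem_toOpenPartialHomeomorph_source he (by simp)
  have hΦ : ∀ u, Φ u = H u := fun _ => rfl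
  have hHa : H a ∈ Φ.target := Φ.map_source hΦa
  have hsa : Φ.symm (H a) = a := Φ.left_inv hΦa
  have hΨ : ContDiffAt 𝕜 ∞ Φ.symm (H a) := hH.to_localInverse he (by simp)
  have hΨt : Tendsto Φ.symm (𝓝 (H a)) (𝓝 a) := by
    simpa [ContinuousAt, hsa] using hΨ.continuousAt
  -- near `a`, the kernel of the differential of `π ∘ f` is the kernel of that of `f`
  have hcont : ContinuousAt (fderiv 𝕜 f) a := hf.continuousAt_fderiv (by simp)
  have hsurj : ∀ᶠ u in 𝓝 a, Function.Surjective (π.comp (fderiv 𝕜 f u)) := by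
    have hc : ContinuousAt (fun u => π.comp (fderiv 𝕜 f u)) a := by fun_prop
    refine hc.eventually_mem (ContinuousLinearMap.isOpen_surjective.mem_nhds ?_)
    rintro ⟨_, u, rfl⟩
    exact ⟨u, Subtype.ext (hπA u)⟩
  have hkerπ : ∀ᶠ u in 𝓝 a, ∀ v, π (fderiv 𝕜 f u v) = 0 → fderiv 𝕜 f u v = 0 := by
    filter_upwards [hsurj, hker] with u hu hku
    -- One inclusion is clear. As `π ∘ df_u` is still onto `R`, its kernel has the dimension of `K`,
    -- and by `hker` the kernel of `df_u` is at least that large.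
    have h1 : LinearMap.ker (fderiv 𝕜 f u).toLinearMap =
        LinearMap.ker (π.comp (fderiv 𝕜 f u)).toLinearMap := by
      refine Submodule.eq_of_le_of_finrank_le (fun v hv => ?_) ?_
      · have : fderiv 𝕜 f u v = 0 := hv
        simp [this]
      · have h2 := LinearMap.finrank_range_add_finrank_ker (π.comp (fderiv 𝕜 f u)).toLinearMap
        rw [LinearMap.range_eq_top.2 hu, finrank_top] at h2
        have h3 := LinearMap.finrank_range_add_finrank_ker A
        change Module.finrank 𝕜 R + Module.finrank 𝕜 K = _ at h3
        change Module.finrank 𝕜 K ≤ _ at hku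
        omega
    intro v hv
    have : v ∈ LinearMap.ker (π.comp (fderiv 𝕜 f u)).toLinearMap := hv
    rw [← h1] at this
    exact this
  have hone : (1 : WithTop ℕ∞) ≤ ∞ := by simp
  have hdiff : ∀ᶠ u in 𝓝 a, DifferentiableAt 𝕜 f u :=
    ((hf.of_le hone).eventually (by simp)).mono fun u hu => hu.differentiableAt (by simp)
  have hdiffΨ : ∀ᶠ q in 𝓝 (H a), DifferentiableAt 𝕜 Φ.symm q :=
    ((hΨ.of_le hone).eventually (by simp)).mono fun u hu => hu.differentiableAt (by simp)
  obtain ⟨r, hr, hball⟩ := Metric.eventually_nhds_iff_ball.1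
    (((hΨt.eventually (hkerπ.and hdiff)).and hdiffΨ).and (Φ.open_target.eventually_mem hHa))
  -- On this slice `π ∘ f` is constant, so its velocities lie in the kernel of `π ∘ df`, which is
  -- that of `df`: hence `f` itself is constant.
  have hconst : ∀ k ∈ Metric.ball (P a) r, f (Φ.symm (π (f a), k)) = f a := by
    have hmem : ∀ k ∈ Metric.ball (P a) r, (π (f a), k) ∈ Metric.ball (H a) r := by
      intro k hk
      rw [Metric.mem_ball, Prod.dist_eq]
      simpa [H, hr] using hk
    intro k hk
    have h0 : ∀ z ∈ Metric.ball (P a) r,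
        HasFDerivAt (fun k => f (Φ.symm (π (f a), k))) (0 : K →L[𝕜] V) z := by
      intro z hz
      obtain ⟨⟨⟨h1, h2⟩, h3⟩, h4⟩ := hball _ (hmem z hz)
      have hd : HasFDerivAt (fun k => f (Φ.symm (π (f a), k)))
          ((fderiv 𝕜 f (Φ.symm (π (f a), z))).comp
            ((fderiv 𝕜 Φ.symm (π (f a), z)).comp (ContinuousLinearMap.inr 𝕜 R K))) z :=
        h2.hasFDerivAt.comp z (h3.hasFDerivAt.comp z (hasFDerivAt_prodMk_right (π (f a)) z))
      have hπd := (π.hasFDerivAt.comp z hd).unique ((hasFDerivAt_const (π (f a)) z).congr_of_eventuallyEq (by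
        filter_upwards [Metric.isOpen_ball.eventually_mem hz] with y hy
        exact congrArg Prod.fst (Φ.right_inv (hball _ (hmem y hy)).2)))
      convert hd
      ext v
      exact (h1 _ (congrArg (fun l : K →L[𝕜] R => l v) hπd)).symm
    have := constant_on_ball_of_hasFDerivAt_zero h0 hk
    rw [this]
    exact congrArg f hsa
  intro w
  by_contra hw
  -- Since `π` kills `w'`, the local right inverse `g` sends the line `f a + ε w'` into the slice
  -- where `f` equals `f a`. This forces `ε w' = 0`, absurd for small `ε ≠ 0`.
  set w' : V := w - π w with hw'
  have hπw' : π w' = 0 := by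
    rw [hw', map_sub, sub_eq_zero]
    exact (hπ (π w)).symm
  have hw'0 : w' ≠ 0 := by
    intro h0
    obtain ⟨u, hu⟩ := (π w).2
    exact hw ⟨u, hu.trans (sub_eq_zero.1 h0).symm⟩
  have hy : Tendsto (fun ε : 𝕜 => f a + ε • w') (𝓝 0) (𝓝 (f a)) := by
    have : Continuous fun ε : 𝕜 => f a + ε • w' := by fun_prop
    simpa using this.tendsto 0
  have hPt : Tendsto (fun ε : 𝕜 => P (g (f a + ε • w'))) (𝓝 0) (𝓝 (P a)) :=
    (P.continuous.tendsto a).comp (hg.comp hy)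
  have hev : ∀ᶠ ε : 𝕜 in 𝓝[≠] 0, False := by
    filter_upwards [nhdsWithin_le_nhds (hy.eventually hfg), self_mem_nhdsWithin,
      nhdsWithin_le_nhds ((hg.comp hy).eventually (Φ.open_source.eventually_mem hΦa)),
      nhdsWithin_le_nhds (hPt.eventually (Metric.ball_mem_nhds (P a) hr))] with ε h1 h2 h3 h4
    have h5 : H (g (f a + ε • w')) = (π (f a), P (g (f a + ε • w'))) := by
      simp only [H, h1, map_add, map_smul, hπw', smul_zero, add_zero]
    simp only [Function.comp_apply] at h3
    have h6 := hconst _ h4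
    rw [← h5, ← hΦ, Φ.left_inv h3, h1] at h6
    exact smul_ne_zero h2 hw'0 (by simpa using h6)
  exact hev.exists.elim fun _ h => h

end ConstantRank

/-! ### Groupoid algebra, inverse equivalences and continuous division -/

namespace LieGroupoid

variable {𝕜 : Type v} [RCLike 𝕜] (Γ : LieGroupoid.{v, u} 𝕜)

theorem eq_inv_of_mul_eq_unit {g h : Γ.Arr} (hgh : Γ.tgt g = Γ.src h)
    (hm : Γ.mul g h = Γ.unit (Γ.src g)) : h = Γ.inv g := by
  calc h = Γ.mul (Γ.unit (Γ.src h)) h := (Γ.unit_mul h).symm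
    _ = Γ.mul (Γ.mul (Γ.inv g) g) h := by rw [Γ.inv_mul, hgh]
    _ = Γ.mul (Γ.inv g) (Γ.unit (Γ.src g)) := by rw [Γ.mul_assoc _ _ _ (Γ.tgt_inv g) hgh, hm]
    _ = Γ.inv g := by rw [← Γ.tgt_inv g, Γ.mul_unit]

theorem inv_unit (m : Γ.Obj) : Γ.inv (Γ.unit m) = Γ.unit m := by
  refine (Γ.eq_inv_of_mul_eq_unit (by rw [Γ.tgt_unit, Γ.src_unit]) ?_).symm
  have h := Γ.mul_unit (Γ.unit m)
  rw [Γ.tgt_unit] at h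
  rw [h, Γ.src_unit]

theorem inv_inv (g : Γ.Arr) : Γ.inv (Γ.inv g) = g :=
  (Γ.eq_inv_of_mul_eq_unit (Γ.tgt_inv g) (by rw [Γ.inv_mul, Γ.src_inv])).symm

theorem inv_mul_rev {g h : Γ.Arr} (hgh : Γ.tgt g = Γ.src h) :
    Γ.inv (Γ.mul g h) = Γ.mul (Γ.inv h) (Γ.inv g) := by
  have h1 : Γ.tgt (Γ.inv h) = Γ.src (Γ.inv g) := by rw [Γ.tgt_inv, Γ.src_inv, hgh]
  refine (Γ.eq_inv_of_mul_eq_unit (by rw [Γ.tgt_mul _ _ hgh, Γ.src_mul _ _ h1, Γ.src_inv]) ?_).symm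
  rw [Γ.mul_assoc _ _ _ hgh (by rw [Γ.src_mul _ _ h1, Γ.src_inv]),
    ← Γ.mul_assoc h _ _ (Γ.src_inv h).symm h1, Γ.mul_inv, Γ.src_mul _ _ hgh, ← hgh, ← Γ.src_inv g,
    Γ.unit_mul, Γ.mul_inv]

theorem inv_mul_cancel_left {g h : Γ.Arr} (hgh : Γ.tgt g = Γ.src h) :
    Γ.mul (Γ.inv g) (Γ.mul g h) = h := by
  rw [← Γ.mul_assoc _ _ _ (Γ.tgt_inv g) hgh, Γ.inv_mul, hgh, Γ.unit_mul]

theorem continuous_src : Continuous Γ.src := Γ.submersion_src.contMDiff.continuous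

theorem continuous_tgt : Continuous Γ.tgt := Γ.submersion_tgt.contMDiff.continuous

theorem continuous_inv : Continuous Γ.inv := Γ.smooth_inv.continuous

theorem isOpenMap_src : IsOpenMap Γ.src := Mfd.IsSubmersion.isOpenMap Γ.submersion_src

theorem isOpenMap_tgt : IsOpenMap Γ.tgt := Mfd.IsSubmersion.isOpenMap Γ.submersion_tgt

/-- Preimages under the open continuous maps `src` and `tgt` commute with closure. -/
theorem IsStable.closure {S : Set Γ.Obj} (hS : Γ.IsStable S) : Γ.IsStable (closure S) := by
  have h : Γ.tgt ⁻¹' S = Γ.src ⁻¹' S := Set.ext hS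
  have h' : Γ.tgt ⁻¹' _root_.closure S = Γ.src ⁻¹' _root_.closure S := by
    rw [Γ.isOpenMap_tgt.preimage_closure_eq_closure_preimage Γ.continuous_tgt, h,
      Γ.isOpenMap_src.preimage_closure_eq_closure_preimage Γ.continuous_src]
  exact fun g => Set.ext_iff.1 h' g

end LieGroupoid

namespace LieMoritaEquivalence

variable {𝕜 : Type v} [RCLike 𝕜] {Γ Γ' : LieGroupoid.{v, u} 𝕜}
  (Φ : LieMoritaEquivalence.{v, u, w} Γ Γ')

theorem continuous_p : Continuous Φ.p := Φ.submersion_p.contMDiff.continuous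

theorem continuous_p' : Continuous Φ.p' := Φ.submersion_p'.contMDiff.continuous

theorem isOpenMap_p : IsOpenMap Φ.p := Mfd.IsSubmersion.isOpenMap Φ.submersion_p

theorem isOpenMap_p' : IsOpenMap Φ.p' := Mfd.IsSubmersion.isOpenMap Φ.submersion_p'

/-- The inverse Morita equivalence, with the same space `X`. -/
def symm : LieMoritaEquivalence.{v, u, w} Γ' Γ where
  X := Φ.X
  p := Φ.p'
  p' := Φ.p
  submersion_p := Φ.submersion_p'
  submersion_p' := Φ.submersion_p
  surjective_p := Φ.surjective_p'
  surjective_p' := Φ.surjective_p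
  left :=
    { act := fun g x => Φ.right.act x (Γ'.inv g)
      moment_act := fun g x h => by
        rw [Φ.right.moment_act _ _ (by rw [Γ'.src_inv, h]), Γ'.tgt_inv]
      unit_act := fun x => by rw [Γ'.inv_unit, Φ.right.act_unit]
      mul_act := fun g h x hgh hx => by
        rw [Γ'.inv_mul_rev hgh, Φ.right.act_mul _ _ _ (by rw [Γ'.src_inv, hx])
          (by rw [Γ'.tgt_inv, Γ'.src_inv, hgh])]
      smooth_act := Φ.right.smooth_act.comp
        ((contMDiff_snd.prodMk (Γ'.smooth_inv.comp contMDiff_fst)).contMDiffOn)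
        fun q hq => by
          have hq' : Γ'.tgt q.1 = Φ.p' q.2 := hq
          change Φ.p' q.2 = Γ'.src (Γ'.inv q.1)
          rw [Γ'.src_inv, hq'] }
  right :=
    { act := fun x g => Φ.left.act (Γ.inv g) x
      moment_act := fun x g h => by
        rw [Φ.left.moment_act _ _ (by rw [Γ.tgt_inv, h]), Γ.src_inv]
      act_unit := fun x => by rw [Γ.inv_unit, Φ.left.unit_act]
      act_mul := fun x g h hx hgh => by
        rw [Γ.inv_mul_rev hgh, Φ.left.mul_act _ _ _ (by rw [Γ.tgt_inv, Γ.src_inv, hgh])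
          (by rw [Γ.tgt_inv, hx])]
      smooth_act := Φ.left.smooth_act.comp
        (((Γ.smooth_inv.comp contMDiff_snd).prodMk contMDiff_fst).contMDiffOn)
        fun q hq => by
          have hq' : Φ.p q.1 = Γ.src q.2 := hq
          change Γ.tgt (Γ.inv q.2) = Φ.p q.1
          rw [Γ.tgt_inv, hq'] }
  p'_left := fun g x h => Φ.p_right _ _ (by rw [Γ'.src_inv, h])
  p_right := fun x g h => Φ.p'_left _ _ (by rw [Γ.tgt_inv, h])
  comm := fun g x g' h h' => (Φ.comm _ _ _ (by rw [Γ.tgt_inv, h']) (by rw [Γ'.src_inv, h])).symm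
  proper_left := by
    let α : {q : Γ'.Arr × Φ.X // Γ'.tgt q.1 = Φ.p' q.2} ≃ₜ
        {q : Φ.X × Γ'.Arr // Φ.p' q.1 = Γ'.src q.2} :=
      { toFun := fun q => ⟨(q.1.2, Γ'.inv q.1.1), by rw [Γ'.src_inv, q.2]⟩
        invFun := fun q => ⟨(Γ'.inv q.1.2, q.1.1), by rw [Γ'.tgt_inv, q.2]⟩
        left_inv := fun q => Subtype.ext (Prod.ext (Γ'.inv_inv _) rfl)
        right_inv := fun q => Subtype.ext (Prod.ext rfl (Γ'.inv_inv _))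
        continuous_toFun := by have := Γ'.continuous_inv; fun_prop
        continuous_invFun := by have := Γ'.continuous_inv; fun_prop }
    exact ((Homeomorph.prodComm Φ.X Φ.X).isProperMap.comp Φ.proper_right).comp α.isProperMap
  proper_right := by
    let α : {q : Φ.X × Γ.Arr // Φ.p q.1 = Γ.src q.2} ≃ₜ
        {q : Γ.Arr × Φ.X // Γ.tgt q.1 = Φ.p q.2} :=
      { toFun := fun q => ⟨(Γ.inv q.1.2, q.1.1), by rw [Γ.tgt_inv, q.2]⟩
        invFun := fun q => ⟨(q.1.2, Γ.inv q.1.1), by rw [Γ.src_inv, q.2]⟩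
        left_inv := fun q => Subtype.ext (Prod.ext rfl (Γ.inv_inv _))
        right_inv := fun q => Subtype.ext (Prod.ext (Γ.inv_inv _) rfl)
        continuous_toFun := by have := Γ.continuous_inv; fun_prop
        continuous_invFun := by have := Γ.continuous_inv; fun_prop }
    exact ((Homeomorph.prodComm Φ.X Φ.X).isProperMap.comp Φ.proper_left).comp α.isProperMap
  free_left := fun g x h hx => by
    have := Φ.free_right x _ (by rw [Γ'.src_inv, h]) hx
    rw [← Γ'.inv_inv g, this, Γ'.inv_unit]
  free_right := fun x g h hx => by
    have := Φ.free_left _ x (by rw [Γ.tgt_inv, h]) hx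
    rw [← Γ.inv_inv g, this, Γ.inv_unit]
  transitive_left := fun x y h => by
    obtain ⟨g, hg, hgx⟩ := Φ.transitive_right x y h
    exact ⟨Γ'.inv g, by rw [Γ'.tgt_inv, hg], (congrArg (Φ.right.act x) (Γ'.inv_inv g)).trans hgx⟩
  transitive_right := fun x y h => by
    obtain ⟨g, hg, hgx⟩ := Φ.transitive_left x y h
    exact ⟨Γ.inv g, by rw [Γ.src_inv, hg], (congrArg (fun k => Φ.left.act k x) (Γ.inv_inv g)).trans hgx⟩

theorem left_cancel {g h : Γ.Arr} {x : Φ.X} (hg : Γ.tgt g = Φ.p x) (hh : Γ.tgt h = Φ.p x)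
    (e : Φ.left.act g x = Φ.left.act h x) : g = h := by
  have hs : Γ.src g = Γ.src h := by rw [← Φ.left.moment_act _ _ hg, e, Φ.left.moment_act _ _ hh]
  have h1 : Γ.tgt (Γ.inv h) = Γ.src g := by rw [Γ.tgt_inv, hs]
  have h2 : Γ.mul (Γ.inv h) g = Γ.unit (Φ.p x) := by
    refine Φ.free_left _ _ (by rw [Γ.tgt_mul _ _ h1, hg]) ?_
    rw [Φ.left.mul_act _ _ _ h1 hg, e, ← Φ.left.mul_act _ _ _ (Γ.tgt_inv h) hh, Γ.inv_mul, hh,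
      Φ.left.unit_act]
  have h3 := Γ.eq_inv_of_mul_eq_unit h1 (by rw [h2, Γ.src_inv, hh])
  rw [h3, Γ.inv_inv]

theorem right_cancel {g h : Γ'.Arr} {x : Φ.X} (hg : Φ.p' x = Γ'.src g) (hh : Φ.p' x = Γ'.src h)
    (e : Φ.right.act x g = Φ.right.act x h) : g = h := by
  have := Φ.symm.left_cancel (g := Γ'.inv g) (h := Γ'.inv h) (x := x)
    (by rw [Γ'.tgt_inv]; exact hg.symm) (by rw [Γ'.tgt_inv]; exact hh.symm)
    (by simpa [symm, Γ'.inv_inv] using e)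
  rw [← Γ'.inv_inv g, this, Γ'.inv_inv]

/-- Division for the left action is continuous. -/
theorem tendsto_of_tendsto_left_act {T : Type*} {l : Filter T} {a : T → Φ.X} {g : T → Γ.Arr}
    {x₀ : Φ.X} {g₀ : Γ.Arr} (h : ∀ t, Γ.tgt (g t) = Φ.p (a t)) (h₀ : Γ.tgt g₀ = Φ.p x₀)
    (ha : Tendsto a l (𝓝 x₀))
    (hga : Tendsto (fun t => Φ.left.act (g t) (a t)) l (𝓝 (Φ.left.act g₀ x₀))) :
    Tendsto g l (𝓝 g₀) := by
  -- Freeness makes the proper map `(g, x) ↦ (g · x, x)` injective, hence a closed embedding, so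
  -- that convergence of the pairs `(g · a, a)` gives that of `(g, a)`.
  have hemb := IsClosedEmbedding.of_continuous_injective_isClosedMap Φ.proper_left.continuous
    (fun q₁ q₂ hq => by
      have h2 : q₁.1.2 = q₂.1.2 := congrArg (fun z : Φ.X × Φ.X => z.2) hq
      have h1 : Φ.left.act q₁.1.1 q₁.1.2 = Φ.left.act q₂.1.1 q₂.1.2 := congrArg (fun z : Φ.X × Φ.X => z.1) hq
      refine Subtype.ext (Prod.ext (Φ.left_cancel q₁.2 (by rw [q₂.2, h2]) ?_) h2)
      rw [h1, h2]) Φ.proper_left.isClosedMap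
  have ht : Tendsto (fun t => (⟨(g t, a t), h t⟩ : {q : Γ.Arr × Φ.X // Γ.tgt q.1 = Φ.p q.2})) l
      (𝓝 ⟨(g₀, x₀), h₀⟩) := by
    rw [hemb.tendsto_nhds_iff]
    exact hga.prodMk_nhds ha
  exact (continuous_fst.comp continuous_subtype_val).continuousAt.tendsto.comp ht

/-- Division for the right action is continuous. -/
theorem continuous_of_continuous_right_act {T : Type*} [TopologicalSpace T] {a : T → Φ.X}
    {g : T → Γ'.Arr} (h : ∀ t, Φ.p' (a t) = Γ'.src (g t)) (ha : Continuous a)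
    (hga : Continuous fun t => Φ.right.act (a t) (g t)) : Continuous g := by
  have hi : Continuous fun t => Γ'.inv (g t) := by
    refine continuous_iff_continuousAt.2 fun t =>
      Φ.symm.tendsto_of_tendsto_left_act (a := a) (x₀ := a t)
        (fun t => by rw [Γ'.tgt_inv]; exact (h t).symm) (by rw [Γ'.tgt_inv]; exact (h t).symm)
        (ha.tendsto t) ?_
    have e (s : T) : Φ.symm.left.act (Γ'.inv (g s)) (a s) = Φ.right.act (a s) (g s) :=
      congrArg (Φ.right.act (a s)) (Γ'.inv_inv (g s))
    rw [funext e, e]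
    exact hga.tendsto t
  simpa [Function.comp_def, Γ'.inv_inv] using Γ'.continuous_inv.comp hi

end LieMoritaEquivalence

/-! ### Kernels of equivariant maps -/

/-- A map which is equivariant with respect to a local family of transformations moving `a` to all
the points near `a` has a differential whose kernel is of locally minimal dimension at `a`. -/
theorem eventually_finrank_ker_le_of_equivariant {𝕜 : Type*} [RCLike 𝕜]
    {F : Type*} [NormedAddCommGroup F] [NormedSpace 𝕜 F] [FiniteDimensional 𝕜 F]
    {V : Type*} [NormedAddCommGroup V] [NormedSpace 𝕜 V]
    {f : F → V} {ξ : F × F → F} {β : F × V → V} {a : F} (hf : ContDiffAt 𝕜 ∞ f a)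
    (hξ : ContDiffAt 𝕜 ∞ ξ (a, a)) (hβ : ContDiffAt 𝕜 ∞ β (a, f a))
    (h₁ : ∀ᶠ k in 𝓝 a, ξ (a, k) = k) (h₂ : ∀ᶠ u in 𝓝 a, ξ (u, a) = u)
    (h₃ : ∀ᶠ q in 𝓝 (a, a), f (ξ q) = β (q.1, f q.2)) :
    ∀ᶠ u in 𝓝 a, Module.finrank 𝕜 (LinearMap.ker (fderiv 𝕜 f a).toLinearMap) ≤
      Module.finrank 𝕜 (LinearMap.ker (fderiv 𝕜 f u).toLinearMap) := by
  have hone : (1 : WithTop ℕ∞) ≤ ∞ := by simp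
  have hfd : ∀ᶠ u in 𝓝 a, DifferentiableAt 𝕜 f u :=
    ((hf.of_le hone).eventually (by simp)).mono fun u hu => hu.differentiableAt (by simp)
  have hξd : ∀ᶠ u in 𝓝 a, DifferentiableAt 𝕜 ξ (u, a) :=
    (Continuous.prodMk_left a).continuousAt.eventually
      (((hξ.of_le hone).eventually (by simp)).mono fun u hu => hu.differentiableAt (by simp))
  have hβd : ∀ᶠ u in 𝓝 a, DifferentiableAt 𝕜 β (u, f a) :=
    (Continuous.prodMk_left (f a)).continuousAt.eventually
      (((hβ.of_le hone).eventually (by simp)).mono fun u hu => hu.differentiableAt (by simp))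
  -- By `h₁` the partial differential of `ξ` in the second variable is the identity at `u = a`, and
  -- injectivity is open.
  have hinj : ∀ᶠ u in 𝓝 a,
      Function.Injective ((fderiv 𝕜 ξ (u, a)).comp (ContinuousLinearMap.inr 𝕜 F F)) := by
    have hc : ContinuousAt
        (fun u => (fderiv 𝕜 ξ (u, a)).comp (ContinuousLinearMap.inr 𝕜 F F)) a := by
      have h : ContinuousAt (fun u => fderiv 𝕜 ξ (u, a)) a :=
        ContinuousAt.comp (f := fun u : F => (u, a)) (hξ.continuousAt_fderiv (by simp))
          (Continuous.prodMk_left a).continuousAt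
      fun_prop
    refine hc.eventually_mem (ContinuousLinearMap.isOpen_injective.mem_nhds ?_)
    have hd := (hξ.differentiableAt (by simp)).hasFDerivAt.comp a (hasFDerivAt_prodMk_right a a)
    have hid := hd.unique ((hasFDerivAt_id (𝕜 := 𝕜) a).congr_of_eventuallyEq h₁)
    change Function.Injective _
    rw [hid]
    exact Function.injective_id
  filter_upwards [hfd, hξd, hβd, hinj, h₂, h₃.curry_nhds] with u hfu hξu hβu hi hu h3
  have hξ' := hξu.hasFDerivAt.comp a (hasFDerivAt_prodMk_right u a)
  have hfu' : HasFDerivAt f (fderiv 𝕜 f u) ((ξ ∘ fun k => (u, k)) a) := by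
    rw [Function.comp_apply, hu]; exact hfu.hasFDerivAt
  have hl := hfu'.comp a hξ'
  have hβ' := hβu.hasFDerivAt.comp (f a) (hasFDerivAt_prodMk_right u (f a))
  have hr := hβ'.comp a (hf.differentiableAt (by simp)).hasFDerivAt
  -- The equivariance differentiated in the second variable: `df_u ∘ T` factors through `df_a`, so
  -- the injective `T` maps `ker df_a` into `ker df_u`.
  have heq := hl.unique (hr.congr_of_eventuallyEq h3)
  set T := (fderiv 𝕜 ξ (u, a)).comp (ContinuousLinearMap.inr 𝕜 F F) with hT
  have hmap : ∀ v ∈ LinearMap.ker (fderiv 𝕜 f a).toLinearMap,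
      T.toLinearMap v ∈ LinearMap.ker (fderiv 𝕜 f u).toLinearMap := by
    intro v hv
    have hv' : fderiv 𝕜 f a v = 0 := hv
    have := congrArg (fun l : F →L[𝕜] V => l v) heq
    simp only [ContinuousLinearMap.comp_apply, hv', map_zero] at this
    exact this
  exact LinearMap.finrank_le_finrank_of_injective (f := T.toLinearMap.restrict hmap)
    fun v₁ v₂ hv => Subtype.ext (hi (congrArg Subtype.val hv))

section SmoothComposition

variable {𝕜 : Type*} [NontriviallyNormedField 𝕜]
  {E : Type*} [NormedAddCommGroup E] [NormedSpace 𝕜 E] {H : Type*} [TopologicalSpace H]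
  {E' : Type*} [NormedAddCommGroup E'] [NormedSpace 𝕜 E'] {H' : Type*} [TopologicalSpace H']
  {E'' : Type*} [NormedAddCommGroup E''] [NormedSpace 𝕜 E''] {H'' : Type*} [TopologicalSpace H'']
  {I : ModelWithCorners 𝕜 E H} {J : ModelWithCorners 𝕜 E' H'} {K : ModelWithCorners 𝕜 E'' H''}
  {M : Type*} [TopologicalSpace M] [ChartedSpace H M]
  {N : Type*} [TopologicalSpace N] [ChartedSpace H' N]
  {P : Type*} [TopologicalSpace P] [ChartedSpace H'' P]

/-- Products and actions are smooth only on the set of composable pairs, in general not a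
neighbourhood of its points; a smooth map staying in this set still has a smooth composite. -/
theorem ContMDiffOn.comp_contMDiffAt_of_eventually {n : WithTop ℕ∞} {g : N → P} {s : Set N}
    (hg : ContMDiffOn J K n g s) {f : M → N} {x : M} (hf : ContMDiffAt I J n f x)
    (h : ∀ᶠ y in 𝓝 x, f y ∈ s) : ContMDiffAt I K n (fun y => g (f y)) x := by
  have h' : univ ∩ f ⁻¹' s ∈ 𝓝 x := by rw [univ_inter]; exact h
  exact ((hg _ h.self_of_nhds).comp' x hf.contMDiffWithinAt).contMDiffAt h'

end SmoothComposition

/-! ### The orbit map is a submersion onto the fibre -/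

namespace LieGroupoid

variable {𝕜 : Type v} [RCLike 𝕜] (Γ : LieGroupoid.{v, u} 𝕜) {m : Γ.Obj}
  (c : Mfd.SubmersionChart Γ.tgt (Γ.unit m))

/-- A family of local sections of `tgt`: the one of parameter `c.coord (Γ.unit m)` is `Γ.unit`. -/
noncomputable def unitSection (q : c.F × Γ.Obj) : Γ.Arr :=
  c.e.symm (q.2, q.1 + c.coord (Γ.unit q.2) - c.coord (Γ.unit m))

theorem tendsto_unitSection_aux : Tendsto (fun q : c.F × Γ.Obj =>
    (q.2, q.1 + c.coord (Γ.unit q.2) - c.coord (Γ.unit m)))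
    (𝓝 (c.coord (Γ.unit m), m)) (𝓝 (Γ.tgt (Γ.unit m), c.coord (Γ.unit m))) := by
  have h1 : Tendsto (fun q : c.F × Γ.Obj => c.coord (Γ.unit q.2)) (𝓝 (c.coord (Γ.unit m), m))
      (𝓝 (c.coord (Γ.unit m))) :=
    c.contMDiffAt_coord.continuousAt.tendsto.comp
      ((Γ.smooth_unit.continuous.tendsto m).comp (continuous_snd.tendsto (c.coord (Γ.unit m), m)))
  have h2 := ((continuous_fst.tendsto (c.coord (Γ.unit m), m)).add h1).sub_const
    (c.coord (Γ.unit m))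
  rw [add_sub_cancel_right] at h2
  refine Tendsto.prodMk_nhds ?_ h2
  rw [Γ.tgt_unit]
  exact continuous_snd.tendsto (c.coord (Γ.unit m), m)

theorem contMDiffAt_unitSection : ContMDiffAt (𝓘(𝕜, c.F).prod Γ.Obj.I) Γ.Arr.I ∞
    (Γ.unitSection c) (c.coord (Γ.unit m), m) := by
  have h1 : ContMDiffAt (𝓘(𝕜, c.F).prod Γ.Obj.I) 𝓘(𝕜, c.F) ∞
      (fun q : c.F × Γ.Obj => c.coord (Γ.unit q.2)) (c.coord (Γ.unit m), m) :=
    ContMDiffAt.comp (g := c.coord) (f := fun q : c.F × Γ.Obj => Γ.unit q.2) _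
      c.contMDiffAt_coord (Γ.smooth_unit.comp contMDiff_snd).contMDiffAt
  have h2 := (contMDiffAt_fst.add h1).sub
    (contMDiffAt_const (c := c.coord (Γ.unit m)) (I := 𝓘(𝕜, c.F).prod Γ.Obj.I))
  exact c.contMDiffOn_symm.comp_contMDiffAt_of_eventually (contMDiffAt_snd.prodMk h2)
    ((Γ.tendsto_unitSection_aux c).eventually c.target_mem_nhds)

theorem eventually_tgt_unitSection :
    ∀ᶠ q in 𝓝 (c.coord (Γ.unit m), m), Γ.tgt (Γ.unitSection c q) = q.2 :=
  ((Γ.tendsto_unitSection_aux c).eventually c.target_mem_nhds).mono fun _ hq => c.f_symm hq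

theorem eventually_unitSection_eq_unit :
    ∀ᶠ n in 𝓝 m, Γ.unitSection c (c.coord (Γ.unit m), n) = Γ.unit n := by
  filter_upwards [Γ.smooth_unit.continuous.continuousAt.eventually_mem c.source_mem_nhds] with n hn
  have := c.symm_eq hn
  rw [Γ.tgt_unit] at this
  rw [unitSection, add_sub_cancel_left, this]

theorem unitSection_eq_fib (k : c.F) : Γ.unitSection c (k, m) = c.fib k := by
  rw [unitSection, add_sub_cancel_right, Mfd.SubmersionChart.fib, Γ.tgt_unit]

end LieGroupoid

namespace LieMoritaEquivalence

variable {𝕜 : Type v} [RCLike 𝕜] {Γ Γ' : LieGroupoid.{v, u} 𝕜}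
  (Φ : LieMoritaEquivalence.{v, u, w} Γ Γ') {x : Φ.X}
  (c : Mfd.SubmersionChart Γ.tgt (Γ.unit (Φ.p x))) (d : Mfd.SubmersionChart Φ.p' x)

theorem eventually_tgt_fib : ∀ᶠ k in 𝓝 (c.coord (Γ.unit (Φ.p x))), Γ.tgt (c.fib k) = Φ.p x :=
  c.eventually_f_fib.mono fun k hk => by rw [hk, Γ.tgt_unit]

/-- The orbit map `γ ↦ γ · x`, in the coordinates of the fibre of `tgt`. -/
noncomputable def orbitMap (k : c.F) : Φ.X := Φ.left.act (c.fib k) x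

theorem orbitMap_base : Φ.orbitMap c (c.coord (Γ.unit (Φ.p x))) = x := by
  rw [orbitMap, c.fib_coord, Φ.left.unit_act]

theorem contMDiffAt_orbitMap :
    ContMDiffAt 𝓘(𝕜, c.F) Φ.X.I ∞ (Φ.orbitMap c) (c.coord (Γ.unit (Φ.p x))) :=
  Φ.left.smooth_act.comp_contMDiffAt_of_eventually
    (c.contMDiffAt_fib.prodMk contMDiffAt_const) (Φ.eventually_tgt_fib c)

theorem tendsto_orbitMap : Tendsto (Φ.orbitMap c) (𝓝 (c.coord (Γ.unit (Φ.p x)))) (𝓝 x) := by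
  simpa [ContinuousAt, Φ.orbitMap_base c] using (Φ.contMDiffAt_orbitMap c).continuousAt

/-- The orbit map in the coordinates of the fibres of `tgt` and `p'`. -/
noncomputable def orbitCoord (k : c.F) : d.F := d.coord (Φ.orbitMap c k)

theorem orbitCoord_base : Φ.orbitCoord c d (c.coord (Γ.unit (Φ.p x))) = d.coord x := by
  rw [orbitCoord, orbitMap_base]

theorem contMDiffAt_orbitCoord :
    ContMDiffAt 𝓘(𝕜, c.F) 𝓘(𝕜, d.F) ∞ (Φ.orbitCoord c d) (c.coord (Γ.unit (Φ.p x))) := by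
  refine ContMDiffAt.comp _ (g := d.coord) ?_ (Φ.contMDiffAt_orbitMap c)
  rw [orbitMap_base]
  exact d.contMDiffAt_coord

theorem eventually_p'_orbitMap :
    ∀ᶠ k in 𝓝 (c.coord (Γ.unit (Φ.p x))), Φ.p' (Φ.orbitMap c k) = Φ.p' x :=
  (Φ.eventually_tgt_fib c).mono fun _ hk => Φ.p'_left _ _ hk

theorem eventually_p_orbitMap :
    ∀ᶠ k in 𝓝 (c.coord (Γ.unit (Φ.p x))), Φ.p (Φ.orbitMap c k) = Γ.src (c.fib k) :=
  (Φ.eventually_tgt_fib c).mono fun _ hk => Φ.left.moment_act _ _ hk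

theorem eventually_fib_orbitCoord :
    ∀ᶠ k in 𝓝 (c.coord (Γ.unit (Φ.p x))), d.fib (Φ.orbitCoord c d k) = Φ.orbitMap c k := by
  filter_upwards [(Φ.tendsto_orbitMap c).eventually d.source_mem_nhds,
    Φ.eventually_p'_orbitMap c] with k hk hk' using d.fib_coord_of_mem hk hk'

/-- Transitivity chooses an arrow `γ b` moving `x` to the point of coordinate `b`; continuity of
division then forces `γ b` to tend to the unit, whatever the choice. -/
theorem exists_rightInverse_orbitCoord : ∃ g : d.F → c.F,
    Tendsto g (𝓝 (d.coord x)) (𝓝 (c.coord (Γ.unit (Φ.p x)))) ∧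
      ∀ᶠ b in 𝓝 (d.coord x), Φ.orbitCoord c d (g b) = b := by
  classical
  -- The default value `x` keeps `z b` in the fibre of `p'` for every `b`, so that transitivity
  -- applies everywhere.
  let z : d.F → Φ.X := fun b => if Φ.p' (d.fib b) = Φ.p' x then d.fib b else x
  have hz : ∀ᶠ b in 𝓝 (d.coord x), z b = d.fib b := d.eventually_f_fib.mono fun b hb => if_pos hb
  have hz' : ∀ b, Φ.p' x = Φ.p' (z b) := by
    intro b
    by_cases h : Φ.p' (d.fib b) = Φ.p' x
    · simp only [z, if_pos h, h]
    · simp only [z, if_neg h]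
  choose γ hγ hγz using fun b => Φ.transitive_left x (z b) (hz' b)
  have hzt : Tendsto z (𝓝 (d.coord x)) (𝓝 x) := by
    refine Tendsto.congr' (hz.mono fun b hb => hb.symm) ?_
    simpa [ContinuousAt, d.fib_coord] using d.contMDiffAt_fib.continuousAt
  have hγt : Tendsto γ (𝓝 (d.coord x)) (𝓝 (Γ.unit (Φ.p x))) := by
    refine Φ.tendsto_of_tendsto_left_act (a := fun _ => x) hγ (Γ.tgt_unit _) tendsto_const_nhds ?_
    simpa only [hγz, Φ.left.unit_act] using hzt
  refine ⟨fun b => c.coord (γ b), c.contMDiffAt_coord.continuousAt.tendsto.comp hγt, ?_⟩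
  filter_upwards [hγt.eventually c.source_mem_nhds, hz, d.eventually_coord_fib] with b h1 h2 h3
  have h4 : c.fib (c.coord (γ b)) = γ b :=
    c.fib_coord_of_mem h1 ((hγ b).trans (Γ.tgt_unit (Φ.p x)).symm)
  rw [orbitCoord, orbitMap, h4, hγz, h2, h3]

/-- The translations in the coordinates of the fibre of `tgt`. -/
noncomputable def translate (q : c.F × c.F) : c.F :=
  c.coord (Γ.mul (Γ.unitSection c (q.1, Γ.src (c.fib q.2))) (c.fib q.2))

/-- The translations in the coordinates of the fibre of `p'`. -/
noncomputable def translate' (q : c.F × d.F) : d.F :=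
  d.coord (Φ.left.act (Γ.unitSection c (q.1, Φ.p (d.fib q.2))) (d.fib q.2))

end LieMoritaEquivalence

namespace LieMoritaEquivalence

variable {𝕜 : Type v} [RCLike 𝕜] {Γ Γ' : LieGroupoid.{v, u} 𝕜}
  (Φ : LieMoritaEquivalence.{v, u, w} Γ Γ') {x : Φ.X}
  (c : Mfd.SubmersionChart Γ.tgt (Γ.unit (Φ.p x))) (d : Mfd.SubmersionChart Φ.p' x)

theorem src_fib_base {m : Γ.Obj} (c : Mfd.SubmersionChart Γ.tgt (Γ.unit m)) :
    Γ.src (c.fib (c.coord (Γ.unit m))) = m := by rw [c.fib_coord, Γ.src_unit]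

theorem contMDiffAt_unitSection_src :
    ContMDiffAt 𝓘(𝕜, c.F × c.F) Γ.Arr.I ∞
      (fun q : c.F × c.F => Γ.unitSection c (q.1, Γ.src (c.fib q.2)))
      (c.coord (Γ.unit (Φ.p x)), c.coord (Γ.unit (Φ.p x))) := by
  have h1 : ContMDiffAt 𝓘(𝕜, c.F × c.F) Γ.Arr.I ∞ (fun q : c.F × c.F => c.fib q.2)
      (c.coord (Γ.unit (Φ.p x)), c.coord (Γ.unit (Φ.p x))) :=
    ContMDiffAt.comp (g := c.fib) _ c.contMDiffAt_fib contDiff_snd.contMDiff.contMDiffAt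
  have h2 := (Γ.submersion_src.contMDiff.contMDiffAt).comp _ h1
  exact ContMDiffAt.comp_of_eq (g := Γ.unitSection c)
    (f := fun q : c.F × c.F => (q.1, Γ.src (c.fib q.2))) (Γ.contMDiffAt_unitSection c)
    (contDiff_fst.contMDiff.contMDiffAt.prodMk h2) (Prod.ext rfl (src_fib_base c))

theorem eventually_composable : ∀ᶠ q in 𝓝 (c.coord (Γ.unit (Φ.p x)), c.coord (Γ.unit (Φ.p x))),
    Γ.tgt (Γ.unitSection c (q.1, Γ.src (c.fib q.2))) = Γ.src (c.fib q.2) := by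
  have h : Tendsto (fun q : c.F × c.F => (q.1, Γ.src (c.fib q.2)))
      (𝓝 (c.coord (Γ.unit (Φ.p x)), c.coord (Γ.unit (Φ.p x))))
      (𝓝 (c.coord (Γ.unit (Φ.p x)), Φ.p x)) := by
    refine (continuous_fst.tendsto _).prodMk_nhds ?_
    have := (Γ.continuous_src.continuousAt.comp c.contMDiffAt_fib.continuousAt).tendsto
    rw [Function.comp_apply, src_fib_base] at this
    exact this.comp (continuous_snd.tendsto _)
  exact h.eventually (Γ.eventually_tgt_unitSection c)

theorem contMDiffAt_translate_arr :
    ContMDiffAt 𝓘(𝕜, c.F × c.F) Γ.Arr.I ∞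
      (fun q : c.F × c.F => Γ.mul (Γ.unitSection c (q.1, Γ.src (c.fib q.2))) (c.fib q.2))
      (c.coord (Γ.unit (Φ.p x)), c.coord (Γ.unit (Φ.p x))) := by
  have h1 : ContMDiffAt 𝓘(𝕜, c.F × c.F) Γ.Arr.I ∞ (fun q : c.F × c.F => c.fib q.2)
      (c.coord (Γ.unit (Φ.p x)), c.coord (Γ.unit (Φ.p x))) :=
    ContMDiffAt.comp (g := c.fib) _ c.contMDiffAt_fib contDiff_snd.contMDiff.contMDiffAt
  exact Γ.smooth_mul.comp_contMDiffAt_of_eventually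
    ((Φ.contMDiffAt_unitSection_src c).prodMk h1) (Φ.eventually_composable c)

theorem translate_arr_base :
    Γ.mul (Γ.unitSection c (c.coord (Γ.unit (Φ.p x)), Γ.src (c.fib (c.coord (Γ.unit (Φ.p x))))))
      (c.fib (c.coord (Γ.unit (Φ.p x)))) = Γ.unit (Φ.p x) := by
  rw [src_fib_base, Γ.unitSection_eq_fib, c.fib_coord]
  simpa [Γ.tgt_unit] using Γ.mul_unit (Γ.unit (Φ.p x))

theorem contDiffAt_translate : ContDiffAt 𝕜 ∞ (translate Φ c)
    (c.coord (Γ.unit (Φ.p x)), c.coord (Γ.unit (Φ.p x))) :=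
  (ContMDiffAt.comp_of_eq c.contMDiffAt_coord (Φ.contMDiffAt_translate_arr c)
    (Φ.translate_arr_base c)).contDiffAt

theorem contDiffAt_translate' : ContDiffAt 𝕜 ∞ (translate' Φ c d)
    (c.coord (Γ.unit (Φ.p x)), d.coord x) := by
  have h1 : ContMDiffAt 𝓘(𝕜, c.F × d.F) Φ.X.I ∞ (fun q : c.F × d.F => d.fib q.2)
      (c.coord (Γ.unit (Φ.p x)), d.coord x) :=
    ContMDiffAt.comp (g := d.fib) _ d.contMDiffAt_fib contDiff_snd.contMDiff.contMDiffAt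
  have h2 := (contDiff_fst.contMDiff.contMDiffAt (n := ∞)).prodMk
    ((Φ.submersion_p.contMDiff.contMDiffAt).comp _ h1)
  have hbase : (c.coord (Γ.unit (Φ.p x)), Φ.p (d.fib (d.coord x))) =
      (c.coord (Γ.unit (Φ.p x)), Φ.p x) := by rw [d.fib_coord]
  have h3 := ContMDiffAt.comp_of_eq (g := Γ.unitSection c)
    (f := fun q : c.F × d.F => (q.1, Φ.p (d.fib q.2))) (Γ.contMDiffAt_unitSection c) h2 hbase
  have h4 := Φ.left.smooth_act.comp_contMDiffAt_of_eventually (h3.prodMk h1) (by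
    have := h2.continuousAt.tendsto
    rw [show (((Prod.fst : c.F × d.F → c.F) (c.coord (Γ.unit (Φ.p x)), d.coord x)),
      (Φ.p ∘ fun q : c.F × d.F => d.fib q.2) (c.coord (Γ.unit (Φ.p x)), d.coord x)) = _
      from hbase] at this
    exact this.eventually (Γ.eventually_tgt_unitSection c))
  refine (ContMDiffAt.comp_of_eq d.contMDiffAt_coord h4 ?_).contDiffAt
  simp only [Function.comp_apply]
  rw [d.fib_coord, Γ.unitSection_eq_fib, c.fib_coord, Φ.left.unit_act]

theorem eventually_translate_base_left : ∀ᶠ k in 𝓝 (c.coord (Γ.unit (Φ.p x))),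
    translate Φ c (c.coord (Γ.unit (Φ.p x)), k) = k := by
  have h : Tendsto (fun k => Γ.src (c.fib k)) (𝓝 (c.coord (Γ.unit (Φ.p x)))) (𝓝 (Φ.p x)) := by
    have := (Γ.continuous_src.continuousAt.comp c.contMDiffAt_fib.continuousAt).tendsto
    rwa [Function.comp_apply, src_fib_base] at this
  filter_upwards [h.eventually (Γ.eventually_unitSection_eq_unit c),
    c.eventually_coord_fib] with k h1 h2
  rw [translate, h1, Γ.unit_mul, h2]

theorem eventually_translate_base_right : ∀ᶠ k in 𝓝 (c.coord (Γ.unit (Φ.p x))),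
    translate Φ c (k, c.coord (Γ.unit (Φ.p x))) = k := by
  filter_upwards [c.eventually_coord_fib, Φ.eventually_tgt_fib c] with k h1 h2
  have h3 := Γ.mul_unit (c.fib k)
  rw [h2] at h3
  rw [translate]
  dsimp only
  rw [src_fib_base, Γ.unitSection_eq_fib, c.fib_coord, h3, h1]

/-- This is `(σ γ) · x = σ · (γ · x)`: since `p (γ · x) = src γ`, both translations use the same
arrow `σ` of `unitSection`. -/
theorem eventually_orbitCoord_translate :
    ∀ᶠ q in 𝓝 (c.coord (Γ.unit (Φ.p x)), c.coord (Γ.unit (Φ.p x))),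
      Φ.orbitCoord c d (translate Φ c q) = translate' Φ c d (q.1, Φ.orbitCoord c d q.2) := by
  have h := (Φ.contMDiffAt_translate_arr c).continuousAt.tendsto
  rw [Φ.translate_arr_base c] at h
  have hs : Tendsto Prod.snd (𝓝 (c.coord (Γ.unit (Φ.p x)), c.coord (Γ.unit (Φ.p x))))
    (𝓝 (c.coord (Γ.unit (Φ.p x)))) := continuous_snd.tendsto _
  filter_upwards [h.eventually c.source_mem_nhds, Φ.eventually_composable c,
    hs.eventually (Φ.eventually_tgt_fib c), hs.eventually (Φ.eventually_fib_orbitCoord c d),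
    hs.eventually (Φ.eventually_p_orbitMap c)] with q h1 h2 h3 h4 h5
  have h6 : c.fib (translate Φ c q) =
      Γ.mul (Γ.unitSection c (q.1, Γ.src (c.fib q.2))) (c.fib q.2) :=
    c.fib_coord_of_mem h1 (by rw [Γ.tgt_mul _ _ h2, h3, Γ.tgt_unit])
  rw [orbitCoord, orbitMap, h6, Φ.left.mul_act _ _ _ h2 h3, translate']
  dsimp only
  rw [h4, h5, orbitMap]

/-- The orbit map is a submersion onto the fibre of `p'`. -/
theorem surjective_fderiv_orbitCoord :
    Function.Surjective (fderiv 𝕜 (Φ.orbitCoord c d) (c.coord (Γ.unit (Φ.p x)))) := by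
  obtain ⟨g, hg, hg'⟩ := Φ.exists_rightInverse_orbitCoord c d
  have hb := Φ.orbitCoord_base c d
  refine surjective_fderiv_of_finrank_ker_le (g := g) (Φ.contMDiffAt_orbitCoord c d).contDiffAt
    (eventually_finrank_ker_le_of_equivariant (ξ := translate Φ c) (β := translate' Φ c d)
      (Φ.contMDiffAt_orbitCoord c d).contDiffAt (Φ.contDiffAt_translate c) ?_
      (Φ.eventually_translate_base_left c) (Φ.eventually_translate_base_right c)
      (Φ.eventually_orbitCoord_translate c d)) ?_ ?_
  · rw [hb]; exact Φ.contDiffAt_translate' c d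
  · rwa [hb]
  · rwa [hb]

end LieMoritaEquivalence

/-! ### Tangent spaces of orbits -/

namespace LieGroupoid

variable {𝕜 : Type v} [RCLike 𝕜] (Γ : LieGroupoid.{v, u} 𝕜)

theorem hasModelDerivAt_src (g : Γ.Arr) :
    HasModelDerivAt Γ.Arr.I Γ.Obj.I Γ.src g (modelDeriv Γ.Arr.I Γ.Obj.I Γ.src g) :=
  Γ.submersion_src.contMDiff.contMDiffAt.hasModelDerivAt

theorem hasModelDerivAt_tgt (g : Γ.Arr) :
    HasModelDerivAt Γ.Arr.I Γ.Obj.I Γ.tgt g (modelDeriv Γ.Arr.I Γ.Obj.I Γ.tgt g) :=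
  Γ.submersion_tgt.contMDiff.contMDiffAt.hasModelDerivAt

theorem hasModelDerivAt_inv (g : Γ.Arr) :
    HasModelDerivAt Γ.Arr.I Γ.Arr.I Γ.inv g (modelDeriv Γ.Arr.I Γ.Arr.I Γ.inv g) :=
  Γ.smooth_inv.contMDiffAt.hasModelDerivAt

theorem src_modelDeriv_inv (m : Γ.Obj) (v : Γ.Arr.E) :
    modelDeriv Γ.Arr.I Γ.Obj.I Γ.src (Γ.unit m)
      (modelDeriv Γ.Arr.I Γ.Arr.I Γ.inv (Γ.unit m) v) =
    modelDeriv Γ.Arr.I Γ.Obj.I Γ.tgt (Γ.unit m) v :=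
  congrArg (fun l : Γ.Arr.E →L[𝕜] Γ.Obj.E => l v)
    (((Γ.hasModelDerivAt_src (Γ.unit m)).comp (Γ.hasModelDerivAt_inv _) (Γ.inv_unit m)).unique
      ((Γ.hasModelDerivAt_tgt _).congr (Eventually.of_forall Γ.src_inv)))

theorem tgt_modelDeriv_inv (m : Γ.Obj) (v : Γ.Arr.E) :
    modelDeriv Γ.Arr.I Γ.Obj.I Γ.tgt (Γ.unit m)
      (modelDeriv Γ.Arr.I Γ.Arr.I Γ.inv (Γ.unit m) v) =
    modelDeriv Γ.Arr.I Γ.Obj.I Γ.src (Γ.unit m) v :=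
  congrArg (fun l : Γ.Arr.E →L[𝕜] Γ.Obj.E => l v)
    (((Γ.hasModelDerivAt_tgt (Γ.unit m)).comp (Γ.hasModelDerivAt_inv _) (Γ.inv_unit m)).unique
      ((Γ.hasModelDerivAt_src _).congr (Eventually.of_forall Γ.tgt_inv)))

/-- The tangent space of an orbit, through `src` on the fibres of `tgt`. -/
theorem mem_orbitTangent_iff {m : Γ.Obj} {e : Γ.Obj.E} : e ∈ Γ.orbitTangent m ↔
    ∃ v, modelDeriv Γ.Arr.I Γ.Obj.I Γ.tgt (Γ.unit m) v = 0 ∧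
      modelDeriv Γ.Arr.I Γ.Obj.I Γ.src (Γ.unit m) v = e := by
  have h : e ∈ Γ.orbitTangent m ↔ ∃ v, modelDeriv Γ.Arr.I Γ.Obj.I Γ.src (Γ.unit m) v = 0 ∧
      modelDeriv Γ.Arr.I Γ.Obj.I Γ.tgt (Γ.unit m) v = e := Iff.rfl
  rw [h]
  constructor
  · rintro ⟨v, h1, h2⟩
    exact ⟨_, (Γ.tgt_modelDeriv_inv m v).trans h1, (Γ.src_modelDeriv_inv m v).trans h2⟩
  · rintro ⟨v, h1, h2⟩
    exact ⟨_, (Γ.src_modelDeriv_inv m v).trans h1, (Γ.tgt_modelDeriv_inv m v).trans h2⟩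

end LieGroupoid

namespace LieMoritaEquivalence

variable {𝕜 : Type v} [RCLike 𝕜] {Γ Γ' : LieGroupoid.{v, u} 𝕜}
  (Φ : LieMoritaEquivalence.{v, u, w} Γ Γ')

/-- The differential of `p`. -/
noncomputable def dp (x : Φ.X) : Φ.X.E →L[𝕜] Γ.Obj.E := modelDeriv Φ.X.I Γ.Obj.I Φ.p x

/-- The differential of `p'`. -/
noncomputable def dp' (x : Φ.X) : Φ.X.E →L[𝕜] Γ'.Obj.E := modelDeriv Φ.X.I Γ'.Obj.I Φ.p' x

theorem hasModelDerivAt_p (x : Φ.X) : HasModelDerivAt Φ.X.I Γ.Obj.I Φ.p x (Φ.dp x) :=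
  Φ.submersion_p.contMDiff.contMDiffAt.hasModelDerivAt

theorem hasModelDerivAt_p' (x : Φ.X) : HasModelDerivAt Φ.X.I Γ'.Obj.I Φ.p' x (Φ.dp' x) :=
  Φ.submersion_p'.contMDiff.contMDiffAt.hasModelDerivAt

theorem surjective_dp (x : Φ.X) : Function.Surjective (Φ.dp x) :=
  Mfd.IsSubmersion.surjective_modelDeriv Φ.submersion_p x

/-- The tangent space of an orbit is the image of the tangent space of the fibre of `p'`. -/
theorem orbitTangent_eq (x : Φ.X) : Γ.orbitTangent (Φ.p x) =
    Submodule.map (Φ.dp x).toLinearMap (LinearMap.ker (Φ.dp' x).toLinearMap) := by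
  obtain ⟨c⟩ := Mfd.nonempty_submersionChart Γ.submersion_tgt (Γ.unit (Φ.p x))
  obtain ⟨d⟩ := Mfd.nonempty_submersionChart Φ.submersion_p' x
  have hι := (Φ.contMDiffAt_orbitMap c).hasModelDerivAt
  set ι' := modelDeriv 𝓘(𝕜, c.F) Φ.X.I (Φ.orbitMap c) (c.coord (Γ.unit (Φ.p x)))
  have h1 : ∀ v, Φ.dp x (ι' v) = modelDeriv Γ.Arr.I Γ.Obj.I Γ.src (Γ.unit (Φ.p x)) (c.dFib v) :=
    fun v => congrArg (fun l : c.F →L[𝕜] Γ.Obj.E => l v)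
      (((Φ.hasModelDerivAt_p x).comp hι (Φ.orbitMap_base c)).unique
        (((Γ.hasModelDerivAt_src _).comp c.hasModelDerivAt_fib c.fib_coord).congr
          (Φ.eventually_p_orbitMap c)))
  have h2 : ∀ v, Φ.dp' x (ι' v) = 0 :=
    fun v => congrArg (fun l : c.F →L[𝕜] Γ'.Obj.E => l v)
      (((Φ.hasModelDerivAt_p' x).comp hι (Φ.orbitMap_base c)).unique
        ((HasModelDerivAt.const (Φ.p' x) _).congr (Φ.eventually_p'_orbitMap c)))
  have hf : HasModelDerivAt 𝓘(𝕜, c.F) 𝓘(𝕜, d.F) (Φ.orbitCoord c d) (c.coord (Γ.unit (Φ.p x)))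
      (fderiv 𝕜 (Φ.orbitCoord c d) (c.coord (Γ.unit (Φ.p x)))) :=
    ((Φ.contMDiffAt_orbitCoord c d).contDiffAt.differentiableAt (by simp)).hasFDerivAt.hasMFDerivAt
  have h3 : ∀ v, ι' v = d.dFib (fderiv 𝕜 (Φ.orbitCoord c d) (c.coord (Γ.unit (Φ.p x))) v) :=
    fun v => congrArg (fun l : c.F →L[𝕜] Φ.X.E => l v)
      (hι.unique ((d.hasModelDerivAt_fib.comp hf (Φ.orbitCoord_base c d)).congr
        ((Φ.eventually_fib_orbitCoord c d).mono fun k hk => hk.symm)))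
  ext e
  rw [Γ.mem_orbitTangent_iff, Submodule.mem_map]
  constructor
  · rintro ⟨v, hv, rfl⟩
    refine ⟨ι' (c.dCoord v), h2 _, ?_⟩
    rw [← c.dFib_dCoord hv]
    simpa [c.dCoord_dFib] using h1 (c.dCoord v)
  · rintro ⟨w, hw, rfl⟩
    -- The submersion property realizes every vector tangent to the fibre of `p'` as a velocity of
    -- the orbit map.
    obtain ⟨v, hv⟩ := Φ.surjective_fderiv_orbitCoord c d (d.dCoord w)
    refine ⟨c.dFib v, c.f_dFib v, ?_⟩
    rw [← h1, h3, hv, d.dFib_dCoord hw]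
    rfl

end LieMoritaEquivalence

/-! ### Tangent spaces of subsets under submersions -/

namespace Mfd

variable {𝕜 : Type v} [RCLike 𝕜]

theorem mem_tangentOfSubset_of_curve {M : Mfd.{v, u} 𝕜} {S : Set M} {m : M} {c : 𝕜 → M}
    (h₀ : c 0 = m) (hc : ContMDiffAt 𝓘(𝕜, 𝕜) M.I ∞ c 0) (hS : ∀ᶠ ε in 𝓝 (0 : 𝕜), c ε ∈ S)
    {c' : 𝕜 →L[𝕜] M.E} (hc' : HasModelDerivAt 𝓘(𝕜, 𝕜) M.I c 0 c') :
    c' 1 ∈ M.tangentOfSubset S m :=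
  Submodule.subset_span ⟨c, h₀, hc, hS,
    congrArg (fun l : 𝕜 →L[𝕜] M.E => l 1) hc'.modelDeriv_eq⟩

theorem tangentOfSubset_le {M : Mfd.{v, u} 𝕜} {S : Set M} {m : M} {T : Submodule 𝕜 M.E}
    (h : ∀ (c : 𝕜 → M) (c' : 𝕜 →L[𝕜] M.E), c 0 = m → ContMDiffAt 𝓘(𝕜, 𝕜) M.I ∞ c 0 →
      (∀ᶠ ε in 𝓝 (0 : 𝕜), c ε ∈ S) → HasModelDerivAt 𝓘(𝕜, 𝕜) M.I c 0 c' → c' 1 ∈ T) :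
    M.tangentOfSubset S m ≤ T := by
  refine Submodule.span_le.2 ?_
  rintro e ⟨c, h₀, hc, hS, rfl⟩
  exact h c _ h₀ hc hS hc.hasModelDerivAt

/-- Under a submersion, the preimage of the tangent space of a subset is the tangent space of
the preimage. -/
theorem comap_tangentOfSubset {X : Mfd.{v, w} 𝕜} {N : Mfd.{v, u} 𝕜} {f : X → N}
    (hf : Manifold.IsSubmersion X.I N.I ∞ f) {S : Set N} {x : X} (hx : f x ∈ S) :
    Submodule.comap (modelDeriv X.I N.I f x).toLinearMap (N.tangentOfSubset S (f x)) =
      X.tangentOfSubset (f ⁻¹' S) x := by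
  obtain ⟨d⟩ := nonempty_submersionChart hf x
  refine le_antisymm ?_ ?_
  -- A vector is the sum of a lift by `sec` and a vertical vector: curves in `S` lift along `sec`,
  -- and straight lines in the fibre coordinate stay over `f x ∈ S`.
  · have hfib (b : d.F) : d.dFib b ∈ X.tangentOfSubset (f ⁻¹' S) x := by
      have hl : ContDiff 𝕜 ∞ fun ε : 𝕜 => d.coord x + ε • b := by fun_prop
      have hl0 : d.coord x + (0 : 𝕜) • b = d.coord x := by simp
      have hld : HasModelDerivAt 𝓘(𝕜, 𝕜) 𝓘(𝕜, d.F) (fun ε : 𝕜 => d.coord x + ε • b) 0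
          ((ContinuousLinearMap.id 𝕜 𝕜).smulRight b) :=
        (((ContinuousLinearMap.id 𝕜 𝕜).smulRight b).hasFDerivAt.const_add
          (d.coord x)).hasMFDerivAt
      have := mem_tangentOfSubset_of_curve (S := f ⁻¹' S) (m := x)
        (c := fun ε : 𝕜 => d.fib (d.coord x + ε • b)) (by rw [hl0, d.fib_coord])
        (ContMDiffAt.comp_of_eq (g := d.fib) d.contMDiffAt_fib hl.contMDiff.contMDiffAt hl0)
        (by
          have ht := hl.continuous.tendsto 0
          rw [hl0] at ht
          filter_upwards [ht.eventually d.eventually_f_fib] with ε hε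
          rw [mem_preimage, hε]
          exact hx) (d.hasModelDerivAt_fib.comp hld hl0)
      simpa using this
    have hsec : Submodule.map d.dSec.toLinearMap (N.tangentOfSubset S (f x)) ≤
        X.tangentOfSubset (f ⁻¹' S) x := by
      rw [Submodule.map_le_iff_le_comap]
      refine tangentOfSubset_le fun c c' h₀ hc hS hc' => ?_
      refine mem_tangentOfSubset_of_curve (c := fun ε => d.sec (c ε)) (by rw [h₀, d.sec_base])
        (ContMDiffAt.comp_of_eq (g := d.sec) d.contMDiffAt_sec hc h₀) ?_
        (d.hasModelDerivAt_sec.comp hc' h₀)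
      have ht := hc.continuousAt.tendsto
      rw [h₀] at ht
      filter_upwards [ht.eventually d.eventually_f_sec, hS] with ε h1 h2
      rwa [mem_preimage, h1]
    intro v hv
    rw [← d.dSec_add_dFib v]
    exact add_mem (hsec ⟨_, hv, rfl⟩) (hfib _)
  · refine tangentOfSubset_le fun c c' h₀ hc hS hc' => ?_
    exact mem_tangentOfSubset_of_curve (c := fun ε => f (c ε)) (by rw [h₀])
      (hf.contMDiff.contMDiffAt.comp 0 hc) hS (d.hasModelDerivAt.comp hc' h₀)

end Mfd

/-- Pulling back along a surjection loses nothing and only adds `ker f` to an image. With `f = dp`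
and `A = ker dp'`, the right-hand side treats `p` and `p'` alike. -/
theorem Submodule.eq_sup_map_iff_comap_eq {𝕜 E E' : Type*} [Ring 𝕜] [AddCommGroup E] [Module 𝕜 E]
    [AddCommGroup E'] [Module 𝕜 E'] {f : E →ₗ[𝕜] E'} (hf : Function.Surjective f)
    {T : Submodule 𝕜 E'} {A B : Submodule 𝕜 E} :
    T = Submodule.map f A ⊔ Submodule.map f B ↔ Submodule.comap f T = LinearMap.ker f ⊔ A ⊔ B := by
  rw [← Submodule.map_sup, sup_assoc, sup_comm (LinearMap.ker f), ← Submodule.comap_map_eq]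
  exact (Submodule.comap_injective_of_surjective hf).eq_iff.symm

/-! ### Stable subsets and their images -/

namespace LieMoritaEquivalence

variable {𝕜 : Type v} [RCLike 𝕜] {Γ Γ' : LieGroupoid.{v, u} 𝕜}
  (Φ : LieMoritaEquivalence.{v, u, w} Γ Γ')

/-- `p'⁻¹(image S) = p⁻¹(S)` for a stable subset `S`. -/
theorem preimage_image {S : Set Γ.Obj} (hS : Γ.IsStable S) : Φ.p' ⁻¹' Φ.image S = Φ.p ⁻¹' S := by
  ext x
  constructor
  · rintro ⟨y, hy, hxy⟩
    obtain ⟨g, hg, rfl⟩ := Φ.transitive_left y x hxy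
    rw [mem_preimage, Φ.left.moment_act _ _ hg, ← hS, hg]
    exact hy
  · exact fun hx => ⟨x, hx, rfl⟩

theorem mem_image_iff {S : Set Γ.Obj} (hS : Γ.IsStable S) (x : Φ.X) :
    Φ.p' x ∈ Φ.image S ↔ Φ.p x ∈ S := Set.ext_iff.1 (Φ.preimage_image hS) x

theorem symm_image_image {S : Set Γ.Obj} (hS : Γ.IsStable S) :
    Φ.symm.image (Φ.image S) = S := by
  change Φ.p '' (Φ.p' ⁻¹' Φ.image S) = S
  rw [Φ.preimage_image hS, image_preimage_eq _ Φ.surjective_p]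

theorem isStable_image {S : Set Γ.Obj} (hS : Γ.IsStable S) : Γ'.IsStable (Φ.image S) := by
  intro g
  obtain ⟨x, hx⟩ := Φ.surjective_p' (Γ'.src g)
  rw [← Φ.right.moment_act x g hx, ← hx, Φ.mem_image_iff hS, Φ.mem_image_iff hS,
    Φ.p_right _ _ hx]

/-- Both sides have preimage `p⁻¹(closure S)` in `X`, because `p` and `p'` are open. -/
theorem closure_image {S : Set Γ.Obj} (hS : Γ.IsStable S) :
    closure (Φ.image S) = Φ.image (closure S) := by
  have h : Φ.p' ⁻¹' closure (Φ.image S) = Φ.p ⁻¹' closure S := by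
    rw [Φ.isOpenMap_p'.preimage_closure_eq_closure_preimage Φ.continuous_p', Φ.preimage_image hS,
      Φ.isOpenMap_p.preimage_closure_eq_closure_preimage Φ.continuous_p]
  change _ = Φ.p' '' (Φ.p ⁻¹' closure S)
  rw [← h, image_preimage_eq _ Φ.surjective_p']

/-- A local equation `f` of `S` gives the local equation `f ∘ p ∘ sec` of the image, where `sec` is
a local section of `p'`. -/
theorem isEmbeddedSubmanifold_image {S : Set Γ.Obj} (hS : Γ.IsStable S)
    (hemb : Γ.Obj.IsEmbeddedSubmanifold S) : Γ'.Obj.IsEmbeddedSubmanifold (Φ.image S) := by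
  rintro _ ⟨x, hx, rfl⟩
  obtain ⟨U, hU, hxU, k, f, hf, hfs, hfS⟩ := hemb _ hx
  obtain ⟨d⟩ := Mfd.nonempty_submersionChart Φ.submersion_p' x
  have hsecC : ContMDiffOn Γ'.Obj.I Φ.X.I ∞ d.sec {n | (n, d.coord x) ∈ d.e.target} :=
    d.contMDiffOn_symm.comp (contMDiff_id.prodMk contMDiff_const).contMDiffOn fun _ h => h
  have hdom : IsOpen {n | (n, d.coord x) ∈ d.e.target} :=
    d.e.open_target.preimage (Continuous.prodMk_left (d.coord x))
  set U₁ : Set Γ'.Obj := {n | (n, d.coord x) ∈ d.e.target} ∩ d.sec ⁻¹' (Φ.p ⁻¹' U) with hU₁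
  have hU₁o : IsOpen U₁ :=
    hsecC.continuousOn.isOpen_inter_preimage hdom (hU.preimage Φ.continuous_p)
  have hxU₁ : Φ.p' x ∈ U₁ := ⟨d.base_mem_target, by
    rw [mem_preimage, d.sec_base]; exact hxU⟩
  have hg : ContMDiffOn Γ'.Obj.I 𝓘(𝕜, EuclideanSpace 𝕜 (Fin k)) ∞
      (fun n => f (Φ.p (d.sec n))) U₁ :=
    hf.comp (Φ.submersion_p.contMDiff.comp_contMDiffOn (hsecC.mono inter_subset_left))
      fun n hn => hn.2
  have hfd : HasModelDerivAt Γ.Obj.I 𝓘(𝕜, EuclideanSpace 𝕜 (Fin k)) f (Φ.p x) _ :=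
    (hf.contMDiffAt (hU.mem_nhds hxU)).hasModelDerivAt
  have hgs : Function.Surjective (modelDeriv Γ'.Obj.I 𝓘(𝕜, EuclideanSpace 𝕜 (Fin k))
      (fun n => f (Φ.p (d.sec n))) (Φ.p' x)) := by
    have hp : HasModelDerivAt Φ.X.I 𝓘(𝕜, EuclideanSpace 𝕜 (Fin k)) (fun z => f (Φ.p z)) x _ :=
      hfd.comp (Φ.hasModelDerivAt_p x) rfl
    -- The fibre of `p'` through `x` lies over `S`, so `f ∘ p` vanishes on it near `x` and its
    -- differential kills vertical vectors.
    have hfibre := (hp.comp d.hasModelDerivAt_fib d.fib_coord).unique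
      ((HasModelDerivAt.const (f (Φ.p x)) (d.coord x)).congr (by
        have ht : Tendsto d.fib (𝓝 (d.coord x)) (𝓝 x) := by
          simpa [ContinuousAt, d.fib_coord] using d.contMDiffAt_fib.continuousAt
        filter_upwards [ht.eventually ((hU.preimage Φ.continuous_p).mem_nhds hxU),
          d.eventually_f_fib] with b h1 h2
        have h3 : Φ.p (d.fib b) ∈ S ∩ U :=
          ⟨by rw [← Φ.mem_image_iff hS, h2]; exact ⟨x, hx, rfl⟩, h1⟩
        have h4 : Φ.p x ∈ S ∩ U := ⟨hx, hxU⟩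
        rw [hfS] at h3 h4
        rw [h3.2, h4.2]))
    have hsec := (hp.comp d.hasModelDerivAt_sec d.sec_base).modelDeriv_eq
    rw [hsec]
    intro b
    obtain ⟨a, ha⟩ := hfs _ hxU b
    obtain ⟨v, rfl⟩ := Φ.surjective_dp x a
    -- Lifting `dp' v` by `sec` returns `v` up to a vertical vector, which `f ∘ p` does not see.
    refine ⟨modelDeriv Φ.X.I Γ'.Obj.I Φ.p' x v, ?_⟩
    have h1 : (modelDeriv Γ.Obj.I 𝓘(𝕜, EuclideanSpace 𝕜 (Fin k)) f (Φ.p x)).comp (Φ.dp x)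
        (d.dFib (d.dCoord v)) = 0 := congrArg (fun l => l (d.dCoord v)) hfibre
    have ha' : (modelDeriv Γ.Obj.I 𝓘(𝕜, EuclideanSpace 𝕜 (Fin k)) f (Φ.p x)).comp (Φ.dp x) v = b :=
      ha
    rw [← ha', ContinuousLinearMap.comp_apply]
    conv_rhs => rw [← d.dSec_add_dFib v, map_add, h1, add_zero]
  obtain ⟨U₂, hU₂, hU₂o, hxU₂⟩ := mem_nhds_iff.1
    (Mfd.eventually_surjective_modelDeriv hU₁o hg hxU₁ hgs)
  refine ⟨U₁ ∩ U₂, hU₁o.inter hU₂o, ⟨hxU₁, hxU₂⟩, k, _, hg.mono inter_subset_left,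
    fun n hn => hU₂ hn.2, ?_⟩
  ext n
  refine ⟨fun ⟨h1, h2⟩ => ⟨h2, ?_⟩, fun ⟨h2, h3⟩ => ⟨?_, h2⟩⟩
  · have h4 : Φ.p (d.sec n) ∈ S ∩ U :=
      ⟨by rw [← Φ.mem_image_iff hS, Mfd.SubmersionChart.sec, d.f_symm h2.1.1]; exact h1, h2.1.2⟩
    rw [hfS] at h4
    exact h4.2
  · have h4 : Φ.p (d.sec n) ∈ S ∩ U := by rw [hfS]; exact ⟨h2.1.2, h3⟩
    have h5 := (Φ.mem_image_iff hS _).2 h4.1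
    rwa [Mfd.SubmersionChart.sec, d.f_symm h2.1.1] at h5

end LieMoritaEquivalence

/-! ### Transfer of density, orbits, transversality and fullness -/

namespace SubgroupoidMoritaEquivalence

variable {𝕜 : Type v} [RCLike 𝕜] {Γ Γ' : LieGroupoid.{v, u} 𝕜} {R : LieSubgroupoid Γ}
  {R' : LieSubgroupoid Γ'} (Φ : SubgroupoidMoritaEquivalence.{v, u, w} R R')

/-- The inverse Morita equivalence of Lie subgroupoids. -/
def symm : SubgroupoidMoritaEquivalence.{v, u, w} R' R where
  X := Φ.X.symm
  Y := Φ.Y.symm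
  i := Φ.i
  immersion_i := Φ.immersion_i
  injective_i := Φ.injective_i
  p_i := Φ.p'_i
  p'_i := Φ.p_i
  equivariant := fun r (y : Φ.Y.X) r' h h' => by
    change Φ.i (Φ.Y.left.act (R.gpd.inv r') (Φ.Y.right.act y (R'.gpd.inv r))) =
      Φ.X.left.act (Γ.inv (R.inclArr r')) (Φ.X.right.act (Φ.i y) (Γ'.inv (R'.inclArr r)))
    have h1 : R.gpd.tgt (R.gpd.inv r') = Φ.Y.p y := (R.gpd.tgt_inv r').trans h'.symm
    have h2 : Φ.Y.p' y = R'.gpd.src (R'.gpd.inv r) := h.symm.trans (R'.gpd.src_inv r).symm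
    rw [← Φ.Y.comm _ _ _ h1 h2, Φ.equivariant _ _ _ h1 h2, R.inv_incl, R'.inv_incl, Φ.X.comm]
    · rw [← R.inv_incl, R.tgt_incl, h1, Φ.p_i]
    · rw [← R'.inv_incl, R'.src_incl, ← h2, Φ.p'_i]

theorem i_left {r : R.gpd.Arr} {y : Φ.Y.X} (h : R.gpd.tgt r = Φ.Y.p y) :
    Φ.i (Φ.Y.left.act r y) = Φ.X.left.act (R.inclArr r) (Φ.i y) := by
  have h' : Φ.Y.p' (Φ.Y.left.act r y) = Φ.Y.p' y := Φ.Y.p'_left _ _ h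
  have h2 : Φ.X.p' (Φ.X.left.act (R.inclArr r) (Φ.i y)) = R'.inclObj (Φ.Y.p' y) := by
    rw [Φ.X.p'_left _ _ (by rw [R.tgt_incl, h, Φ.p_i]), Φ.p'_i]
  have := Φ.equivariant r y (R'.gpd.unit (Φ.Y.p' y)) h (R'.gpd.src_unit _).symm
  rwa [R'.unit_incl, ← h2, Φ.X.right.act_unit, ← h', Φ.Y.right.act_unit] at this

theorem i_right {y : Φ.Y.X} {r : R'.gpd.Arr} (h : Φ.Y.p' y = R'.gpd.src r) :
    Φ.i (Φ.Y.right.act y r) = Φ.X.right.act (Φ.i y) (R'.inclArr r) := by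
  have := Φ.equivariant (R.gpd.unit (Φ.Y.p y)) y r (R.gpd.tgt_unit _) h
  rwa [R.unit_incl, ← Φ.p_i, Φ.X.left.unit_act, Φ.Y.left.unit_act] at this

/-- Density goes up to `Y` because the projection to `L` is open, and down to `L'` because the other
one is a continuous surjection. -/
theorem dense_preimage {S : Set Γ.Obj} (hS : Γ.IsStable S) (h : Dense (R.inclObj ⁻¹' S)) :
    Dense (R'.inclObj ⁻¹' Φ.X.image S) := by
  have h1 := Φ.Y.surjective_p'.denseRange.dense_image Φ.Y.continuous_p'
    (h.preimage Φ.Y.isOpenMap_p)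
  refine h1.mono ?_
  rintro _ ⟨y, hy, rfl⟩
  rw [mem_preimage, ← Φ.p'_i, Φ.X.mem_image_iff hS, Φ.p_i]
  exact hy

/-- If `g` joins `p x` to the point of `L` under `y`, then `x` and `g · i(y)` share a fibre of `p`;
the arrow `g'` with `x · g' = g · i(y)` joins `p' x` to a point of `L'`. -/
theorem meetsOrbits {T : Set Γ.Obj} (hT : Γ.IsStable T) (h : R.MeetsOrbits T) :
    R'.MeetsOrbits (Φ.X.image T) := by
  intro m' hm'
  obtain ⟨x, rfl⟩ := Φ.X.surjective_p' m'
  have hx : Φ.X.p x ∈ T := (Φ.X.mem_image_iff hT x).1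
    (hm' ⟨Γ'.unit (Φ.X.p' x), Γ'.src_unit _, Γ'.tgt_unit _⟩)
  obtain ⟨_, ⟨l, rfl⟩, g, hg, hgl⟩ := h (Φ.X.p x) (by
    rintro _ ⟨g, hg, rfl⟩
    rw [hT, hg]
    exact hx)
  obtain ⟨y, rfl⟩ := Φ.Y.surjective_p l
  have hgy : Γ.tgt g = Φ.X.p (Φ.i y) := by rw [hgl, Φ.p_i]
  obtain ⟨g', hg', hxg⟩ := Φ.X.transitive_right x (Φ.X.left.act g (Φ.i y))
    (by rw [Φ.X.left.moment_act _ _ hgy, hg])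
  refine ⟨_, ⟨Φ.Y.p' y, rfl⟩, g', hg'.symm, ?_⟩
  rw [← Φ.X.right.moment_act _ _ hg', hxg, Φ.X.p'_left _ _ hgy, Φ.p'_i]

/-- The differential of `i`. -/
noncomputable def di (y : Φ.Y.X) : Φ.Y.X.E →L[𝕜] Φ.X.X.E := modelDeriv Φ.Y.X.I Φ.X.X.I Φ.i y

/-- Differentiate `p ∘ i = inclObj ∘ p` and use that `Y → L` is a submersion. -/
theorem range_modelDeriv_inclObj (y : Φ.Y.X) :
    LinearMap.range (modelDeriv R.gpd.Obj.I Γ.Obj.I R.inclObj (Φ.Y.p y)).toLinearMap =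
      Submodule.map (Φ.X.dp (Φ.i y)).toLinearMap (LinearMap.range (Φ.di y).toLinearMap) := by
  have hi : HasModelDerivAt Φ.Y.X.I Φ.X.X.I Φ.i y (Φ.di y) :=
    Φ.immersion_i.contMDiff.contMDiffAt.hasModelDerivAt
  have hincl := (R.immersion_obj.contMDiff.contMDiffAt (x := Φ.Y.p y)).hasModelDerivAt
  have h := ((Φ.X.hasModelDerivAt_p (Φ.i y)).comp hi rfl).unique
    ((hincl.comp (Φ.Y.hasModelDerivAt_p y) rfl).congr (Eventually.of_forall Φ.p_i))
  have h' (v) : Φ.X.dp (Φ.i y) (Φ.di y v) =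
    modelDeriv R.gpd.Obj.I Γ.Obj.I R.inclObj (Φ.Y.p y) (Φ.Y.dp y v) := congrArg (fun l => l v) h
  ext e
  constructor
  · rintro ⟨a, rfl⟩
    obtain ⟨v, rfl⟩ := Φ.Y.surjective_dp y a
    exact ⟨_, ⟨v, rfl⟩, h' v⟩
  · rintro ⟨_, ⟨v, rfl⟩, rfl⟩
    exact ⟨_, (h' v).symm⟩

/-- Transversality read on `X` along `Y`. As `p⁻¹(S) = p'⁻¹(image S)` for stable `S`, the resulting
condition is unchanged when `p` and `p'` are exchanged. -/
theorem isTransverse_iff (S : Set Γ.Obj) : R.IsTransverse S ↔ ∀ y, Φ.X.p (Φ.i y) ∈ S →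
    Φ.X.X.tangentOfSubset (Φ.X.p ⁻¹' S) (Φ.i y) =
      LinearMap.ker (Φ.X.dp (Φ.i y)).toLinearMap ⊔ LinearMap.ker (Φ.X.dp' (Φ.i y)).toLinearMap ⊔
        LinearMap.range (Φ.di y).toLinearMap := by
  have h : R.IsTransverse S ↔ ∀ l, R.inclObj l ∈ S → Γ.Obj.tangentOfSubset S (R.inclObj l) =
      Γ.orbitTangent (R.inclObj l) ⊔
        LinearMap.range (modelDeriv R.gpd.Obj.I Γ.Obj.I R.inclObj l).toLinearMap := Iff.rfl
  rw [h, Φ.Y.surjective_p.forall]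
  refine forall_congr' fun y => ?_
  rw [Φ.range_modelDeriv_inclObj, ← Φ.p_i]
  refine forall_congr' fun hy => ?_
  rw [Φ.X.orbitTangent_eq, Submodule.eq_sup_map_iff_comap_eq (Φ.X.surjective_dp (Φ.i y)),
    ← Mfd.comap_tangentOfSubset Φ.X.submersion_p hy]
  rfl

theorem isTransverse_image {S : Set Γ.Obj} (hS : Γ.IsStable S) (h : R.IsTransverse S) :
    R'.IsTransverse (Φ.X.image S) := by
  rw [Φ.symm.isTransverse_iff]
  intro y hy
  have hy' : Φ.X.p (Φ.i y) ∈ S := (Φ.X.mem_image_iff hS _).1 hy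
  have := (Φ.isTransverse_iff S).1 h y hy'
  rw [← Φ.X.preimage_image hS, sup_comm (LinearMap.ker _) (LinearMap.ker _)] at this
  exact this

theorem isIn_image {S : Set Γ.Obj} (hS : Γ.IsStable S) (h : R.IsIn S) :
    R'.IsIn (Φ.X.image S) :=
  ⟨Φ.dense_preimage hS h.dense, Φ.isTransverse_image hS h.transverse, Φ.meetsOrbits hS h.meets⟩

theorem isSurjectiveIn_image {S : Set Γ.Obj} (hS : Γ.IsStable S) (h : R.IsSurjectiveIn S) :
    R'.IsSurjectiveIn (Φ.X.image S) :=
  ⟨Φ.isIn_image hS h.isIn, by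
    rw [Φ.X.closure_image hS]
    exact Φ.meetsOrbits hS.closure h.meets_closure⟩

/-- Write `i(y₁) · g' = g · i(y₂)`. Fullness puts `g` in `R`, transitivity in `Y` gives `y₁ · r' = g
· y₂`, and freeness in `X` identifies `g'` with `r'`. -/
theorem isFullIn_image {S : Set Γ.Obj} (hS : Γ.IsStable S) (h : R.IsFullIn S) :
    R'.IsFullIn (Φ.X.image S) := by
  refine ⟨Φ.isIn_image hS h.isIn, Set.ext fun g' => ⟨fun hg => hg.2, fun hg => ⟨?_, hg⟩⟩⟩
  obtain ⟨⟨⟨l₁, hl₁⟩, hs₁⟩, ⟨⟨l₂, hl₂⟩, hs₂⟩⟩ := hg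
  obtain ⟨y₁, rfl⟩ := Φ.Y.surjective_p' l₁
  obtain ⟨y₂, rfl⟩ := Φ.Y.surjective_p' l₂
  rw [← Φ.p'_i] at hl₁ hl₂
  rw [← hl₁, Φ.X.mem_image_iff hS] at hs₁
  rw [← hl₂, Φ.X.mem_image_iff hS] at hs₂
  obtain ⟨g, hg, hgy⟩ := Φ.X.transitive_left (Φ.i y₂) (Φ.X.right.act (Φ.i y₁) g')
    (by rw [Φ.X.right.moment_act _ _ hl₁, hl₂])
  have hsrc : Γ.src g = Φ.X.p (Φ.i y₁) := by
    rw [← Φ.X.left.moment_act _ _ hg, hgy, Φ.X.p_right _ _ hl₁]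
  have hmem : g ∈ {g : Γ.Arr | Γ.src g ∈ range R.inclObj ∩ S ∧ Γ.tgt g ∈ range R.inclObj ∩ S} := by
    rw [mem_ofPred_eq, hsrc, hg]
    exact ⟨⟨⟨_, (Φ.p_i y₁).symm⟩, hs₁⟩, ⟨_, (Φ.p_i y₂).symm⟩, hs₂⟩
  rw [← h.full] at hmem
  obtain ⟨⟨r, rfl⟩, -⟩ := hmem
  have hr : R.gpd.tgt r = Φ.Y.p y₂ := R.injective_obj (by rw [← R.tgt_incl, hg, Φ.p_i])
  have hr' : R.gpd.src r = Φ.Y.p y₁ := R.injective_obj (by rw [← R.src_incl, hsrc, Φ.p_i])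
  obtain ⟨r', h1, h2⟩ := Φ.Y.transitive_right y₁ (Φ.Y.left.act r y₂)
    (by rw [Φ.Y.left.moment_act _ _ hr, hr'])
  refine ⟨r', Φ.X.right_cancel (x := Φ.i y₁) (by rw [R'.src_incl, ← h1, Φ.p'_i]) hl₁ ?_⟩
  rw [← Φ.i_right h1, h2, Φ.i_left hr, hgy]

end SubgroupoidMoritaEquivalence

/-! ### The quotient of arrows and properness -/

theorem LieGroupoid.tendsto_mul {𝕜 : Type v} [RCLike 𝕜] (Γ : LieGroupoid.{v, u} 𝕜) {T : Type*}
    {l : Filter T} {a b : T → Γ.Arr} {g h : Γ.Arr} (ha : Tendsto a l (𝓝 g))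
    (hb : Tendsto b l (𝓝 h)) (hab : ∀ᶠ t in l, Γ.tgt (a t) = Γ.src (b t))
    (hgh : Γ.tgt g = Γ.src h) : Tendsto (fun t => Γ.mul (a t) (b t)) l (𝓝 (Γ.mul g h)) :=
  (Γ.smooth_mul.continuousOn (g, h) hgh).tendsto.comp
    (tendsto_nhdsWithin_iff.2 ⟨ha.prodMk_nhds hb, hab⟩)

namespace LieSubgroupoid

variable {𝕜 : Type v} [RCLike 𝕜] {Γ : LieGroupoid.{v, u} 𝕜} (R : LieSubgroupoid Γ)
  {K : Set Γ.Obj}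

theorem equivalence_actRel (K : Set Γ.Obj) : Equivalence (R.actRel K) where
  refl a := ⟨R.gpd.unit a.1.1, R.gpd.tgt_unit _, by
    rw [R.gpd.src_unit, R.unit_incl, a.2.1, Γ.unit_mul]⟩
  symm := by
    rintro a b ⟨r, h1, h2⟩
    refine ⟨R.gpd.inv r, by rw [R.gpd.tgt_inv, h2], ?_⟩
    rw [h2, R.inv_incl, Γ.inv_mul_cancel_left (by rw [R.tgt_incl, h1, a.2.1]), R.gpd.src_inv, h1]
  trans := by
    rintro a b c ⟨r, h1, h2⟩ ⟨s, h3, h4⟩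
    rw [h2] at h3 h4
    refine ⟨R.gpd.mul s r, by rw [R.gpd.tgt_mul _ _ h3, h1], ?_⟩
    rw [h4, R.gpd.src_mul _ _ h3, R.mul_incl _ _ h3,
      Γ.mul_assoc _ _ _ (by rw [R.tgt_incl, R.src_incl, h3]) (by rw [R.tgt_incl, h1, a.2.1])]

/-- If `r` carries `z` into `U`, a local section of the target map of `R` through `r` carries all
nearby elements into `U`, so saturations of open sets are open. -/
theorem isOpenMap_mk_actRel (K : Set Γ.Obj) : IsOpenMap (Quot.mk (R.actRel K)) := by
  intro U hU
  change IsOpen (Quot.mk (R.actRel K) ⁻¹' (Quot.mk (R.actRel K) '' U))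
  rw [isOpen_iff_mem_nhds]
  rintro z ⟨b, hb, hbz⟩
  obtain ⟨r, hr, hrb⟩ := ((R.equivalence_actRel K).quot_mk_eq_iff z b).1 hbz.symm
  obtain ⟨V, hV, rfl⟩ := isOpen_induced_iff.1 hU
  obtain ⟨c⟩ := Mfd.nonempty_submersionChart R.gpd.submersion_tgt r
  have hz1 : Tendsto (fun a : R.ArrowsTo K => a.1.1) (𝓝 z) (𝓝 (R.gpd.tgt r)) := by
    rw [hr]
    exact (continuous_fst.comp continuous_subtype_val).tendsto z
  have hs : Tendsto (fun a : R.ArrowsTo K => c.sec a.1.1) (𝓝 z) (𝓝 r) := by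
    have := c.contMDiffAt_sec.continuousAt.tendsto.comp hz1
    rwa [c.sec_base] at this
  have hst := hz1.eventually c.eventually_f_sec
  have hcomp : ∀ᶠ a : R.ArrowsTo K in 𝓝 z, Γ.tgt (R.inclArr (c.sec a.1.1)) = Γ.src a.1.2 :=
    hst.mono fun a ha => by rw [R.tgt_incl, ha, a.2.1]
  have ht : Tendsto (fun a : R.ArrowsTo K =>
      (R.gpd.src (c.sec a.1.1), Γ.mul (R.inclArr (c.sec a.1.1)) a.1.2)) (𝓝 z) (𝓝 b.1) := by
    rw [hrb]
    refine ((R.gpd.continuous_src.tendsto r).comp hs).prodMk_nhds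
      (Γ.tendsto_mul ((R.immersion_arr.contMDiff.continuous.tendsto r).comp hs)
        ((continuous_snd.comp continuous_subtype_val).tendsto z) hcomp ?_)
    rw [R.tgt_incl, hr, z.2.1]
  filter_upwards [ht.eventually (hV.mem_nhds hb), hst, hcomp] with a h1 h2 h3
  refine ⟨⟨_, ?_⟩, h1, (Quot.sound ⟨c.sec a.1.1, h2, rfl⟩).symm⟩
  rw [Γ.src_mul _ _ h3, Γ.tgt_mul _ _ h3, R.src_incl]
  exact ⟨rfl, a.2.2⟩

/-- The target map on the quotient `R \ Γ_L^K`. -/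
def quotTgt (K : Set Γ.Obj) : Quot (R.actRel K) → Γ.Obj :=
  Quot.lift (fun a => Γ.tgt a.1.2) (by
    rintro a b ⟨r, h1, h2⟩
    rw [h2, Γ.tgt_mul _ _ (by rw [R.tgt_incl, h1, a.2.1])])

theorem continuous_quotTgt (K : Set Γ.Obj) : Continuous (R.quotTgt K) :=
  continuous_quot_lift _ (Γ.continuous_tgt.comp (continuous_snd.comp continuous_subtype_val))

end LieSubgroupoid

/-- A compact space maps onto any space which receives a continuous surjection factoring through
an open quotient onto the compact space. -/
theorem compactSpace_of_isOpenQuotientMap {E D Q : Type*} [TopologicalSpace E] [TopologicalSpace D]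
    [TopologicalSpace Q] [CompactSpace D] {a : E → D} {b : E → Q} (ha : IsOpenQuotientMap a)
    (hb : Continuous b) (hbs : Function.Surjective b) (hab : ∀ e e', a e = a e' → b e = b e') :
    CompactSpace Q := by
  have hf : (fun d => b (Function.surjInv ha.surjective d)) ∘ a = b :=
    funext fun e => hab _ _ (Function.surjInv_eq ha.surjective (a e))
  have hc : Continuous fun d => b (Function.surjInv ha.surjective d) := by
    rw [ha.isQuotientMap.continuous_iff, hf]
    exact hb
  have hs : Function.Surjective fun d => b (Function.surjInv ha.surjective d) := by
    rw [← hf] at hbs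
    exact hbs.of_comp
  rw [← isCompact_univ_iff, ← hs.range_eq]
  exact isCompact_range hc

/-- Finitely many images of compact neighbourhoods cover `K`; their union is then cut down by the
closed set `f ⁻¹' K`. -/
theorem IsOpenMap.exists_isCompact_image_eq {X Y : Type*} [TopologicalSpace X] [TopologicalSpace Y]
    [LocallyCompactSpace X] [T2Space Y] {f : X → Y} (ho : IsOpenMap f) (hc : Continuous f)
    (hs : Function.Surjective f) {K : Set Y} (hK : IsCompact K) :
    ∃ C, IsCompact C ∧ f '' C = K := by
  choose s hs using hs
  choose N hN hxN using fun y => exists_compact_mem_nhds (s y)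
  obtain ⟨t, -, ht⟩ := hK.elim_nhds_subcover (fun y => f '' N y) fun y _ => by
    have := ho.image_mem_nhds (hxN y)
    rwa [hs] at this
  refine ⟨(⋃ y ∈ t, N y) ∩ f ⁻¹' K, (t.isCompact_biUnion fun y _ => hN y).inter_right
    (hK.isClosed.preimage hc), ?_⟩
  refine Subset.antisymm (by rintro _ ⟨x, hx, rfl⟩; exact hx.2) fun y hy => ?_
  obtain ⟨z, hz, x, hx, rfl⟩ := mem_iUnion₂.1 (ht hy)
  exact ⟨x, ⟨mem_iUnion₂.2 ⟨z, hz, hx⟩, hy⟩, rfl⟩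

namespace SubgroupoidMoritaEquivalence

variable {𝕜 : Type v} [RCLike 𝕜] {Γ Γ' : LieGroupoid.{v, u} 𝕜} {R : LieSubgroupoid Γ}
  {R' : LieSubgroupoid Γ'} (Φ : SubgroupoidMoritaEquivalence.{v, u, w} R R')

/-- The map `(y, γ) ↦ [q(y), γ]` from `Y ×_L Γ` to `R \ Γ_L^K`. -/
def toQuot (K : Set Γ.Obj)
    (a : {q : Φ.Y.X × Γ.Arr // R.inclObj (Φ.Y.p q.1) = Γ.src q.2 ∧ Γ.tgt q.2 ∈ K}) :
    Quot (R.actRel K) := Quot.mk _ ⟨(Φ.Y.p a.1.1, a.1.2), a.2⟩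

/-- Openness is what matters: open quotient maps, unlike general ones, survive the product with `C`
and the restriction to `D` made below. -/
theorem isOpenQuotientMap_toQuot (K : Set Γ.Obj) : IsOpenQuotientMap (Φ.toQuot K) := by
  let s : Set (R.gpd.Obj × Γ.Arr) := {q | R.inclObj q.1 = Γ.src q.2 ∧ Γ.tgt q.2 ∈ K}
  let f : Φ.Y.X × Γ.Arr → R.gpd.Obj × Γ.Arr := Prod.map Φ.Y.p id
  have hf : IsOpenMap f := Φ.Y.isOpenMap_p.prodMap IsOpenMap.id
  have hfs : Function.Surjective f := Φ.Y.surjective_p.prodMap Function.surjective_id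
  have hfc : Continuous f := Φ.Y.continuous_p.prodMap continuous_id
  exact
    { surjective := Quot.mk_surjective.comp (Set.restrictPreimage_surjective s hfs)
      continuous := continuous_quot_mk.comp (hfc.restrictPreimage (s := s))
      isOpenMap := (R.isOpenMap_mk_actRel K).comp (hf.restrictPreimage s) }

/-- A pair `([γ], x)` with `tgt γ = p x` is sent to the class of the `g'` solving `i(y) · g' = γ ·
x`, for any `y` over the source of `γ`. This is continuous and onto, from a closed subset of a
product of compact spaces. -/
theorem compactSpace_quot_image {C : Set Φ.X.X} (hC : IsCompact C)
    (hQ : CompactSpace (Quot (R.actRel (Φ.X.p '' C)))) :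
    CompactSpace (Quot (R'.actRel (Φ.X.p' '' C))) := by
  set K := Φ.X.p '' C with hK
  have : CompactSpace C := isCompact_iff_compactSpace.1 hC
  let W := {q : Φ.Y.X × Γ.Arr // R.inclObj (Φ.Y.p q.1) = Γ.src q.2 ∧ Γ.tgt q.2 ∈ K}
  let A : W × C → Quot (R.actRel K) × C := Prod.map (Φ.toQuot K) id
  have hA : IsOpenQuotientMap A := (Φ.isOpenQuotientMap_toQuot K).prodMap IsOpenQuotientMap.id
  let D : Set (Quot (R.actRel K) × C) := {d | R.quotTgt K d.1 = Φ.X.p d.2}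
  have hD : IsClosed D := isClosed_eq ((R.continuous_quotTgt K).comp continuous_fst)
    (Φ.X.continuous_p.comp (continuous_subtype_val.comp continuous_snd))
  have : CompactSpace D := isCompact_iff_compactSpace.1 hD.isCompact
  have ha : IsOpenQuotientMap (D.restrictPreimage A) :=
    { surjective := Set.restrictPreimage_surjective D hA.surjective
      continuous := hA.continuous.restrictPreimage
      isOpenMap := hA.isOpenMap.restrictPreimage D }
  have htgt : ∀ e : A ⁻¹' D, Γ.tgt e.1.1.1.2 = Φ.X.p e.1.2 := fun e => e.2
  have hdiv : ∀ e : A ⁻¹' D, ∃ g', Φ.X.p' (Φ.i e.1.1.1.1) = Γ'.src g' ∧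
      Φ.X.right.act (Φ.i e.1.1.1.1) g' = Φ.X.left.act e.1.1.1.2 e.1.2 := fun e =>
    Φ.X.transitive_right _ _ (by rw [Φ.X.left.moment_act _ _ (htgt e), Φ.p_i, e.1.1.2.1])
  choose g hg hgx using hdiv
  have hW : Continuous fun e : A ⁻¹' D => (e.1.1.1 : Φ.Y.X × Γ.Arr) :=
    continuous_subtype_val.comp (continuous_fst.comp continuous_subtype_val)
  have hC' : Continuous fun e : A ⁻¹' D => (e.1.2 : Φ.X.X) :=
    continuous_subtype_val.comp (continuous_snd.comp continuous_subtype_val)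
  have hgc : Continuous g := by
    refine Φ.X.continuous_of_continuous_right_act hg
      (Φ.immersion_i.contMDiff.continuous.comp hW.fst) ?_
    simp only [hgx]
    exact Φ.X.left.smooth_act.continuousOn.comp_continuous
      (f := fun e : A ⁻¹' D => (e.1.1.1.2, (e.1.2 : Φ.X.X))) (hW.snd.prodMk hC') htgt
  have hg2 : ∀ e, R'.inclObj (Φ.Y.p' e.1.1.1.1) = Γ'.src (g e) ∧ Γ'.tgt (g e) ∈ Φ.X.p' '' C :=
    fun e => ⟨by rw [← hg, Φ.p'_i], e.1.2, e.1.2.2, by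
      rw [← Φ.X.right.moment_act _ _ (hg e), hgx, Φ.X.p'_left _ _ (htgt e)]⟩
  refine compactSpace_of_isOpenQuotientMap (a := D.restrictPreimage A) ha
    (b := fun e => Quot.mk (R'.actRel (Φ.X.p' '' C)) ⟨(Φ.Y.p' e.1.1.1.1, g e), hg2 e⟩)
    (continuous_quot_mk.comp (Continuous.subtype_mk
      ((Φ.Y.continuous_p'.comp hW.fst).prodMk hgc) _)) ?_ ?_
  -- Surjectivity: the same equation is solved for `γ`, with `x ∈ C` chosen over `tgt g'`.
  · rintro ⟨⟨⟨l', g'⟩, hl', ⟨x, hx, hxg⟩⟩⟩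
    obtain ⟨y, rfl⟩ := Φ.Y.surjective_p' l'
    rw [← Φ.p'_i] at hl'
    dsimp only at hl' hxg
    obtain ⟨γ, hγ, hγx⟩ := Φ.X.transitive_left x (Φ.X.right.act (Φ.i y) g')
      (by rw [Φ.X.right.moment_act _ _ hl', hxg])
    have hsrc : R.inclObj (Φ.Y.p y) = Γ.src γ := by
      rw [← Φ.X.left.moment_act _ _ hγ, hγx, Φ.X.p_right _ _ hl', Φ.p_i]
    let e : A ⁻¹' D := ⟨(⟨(y, γ), hsrc, by rw [hγ]; exact ⟨x, hx, rfl⟩⟩, ⟨x, hx⟩), hγ⟩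
    have he : g e = g' := Φ.X.right_cancel (x := Φ.i y) (hg e) hl' ((hgx e).trans hγx)
    refine ⟨e, congrArg (Quot.mk _) (Subtype.ext (Prod.ext rfl he))⟩
  -- Independence of the choices: an `r` relating the two arrows of `Γ` is turned by transitivity in
  -- `Y` into an `r'` relating the two solutions, and freeness in `X` gives the equality of arrows.
  · rintro e e' hee'
    have h1 : Φ.toQuot K e.1.1 = Φ.toQuot K e'.1.1 := congrArg (fun d => d.1.1) hee'
    have h2 : e.1.2 = e'.1.2 := congrArg (fun d => d.1.2) hee'
    obtain ⟨r, h3, h4⟩ := ((R.equivalence_actRel K).quot_mk_eq_iff _ _).1 h1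
    have h5 : Φ.Y.p e'.1.1.1.1 = R.gpd.src r := congrArg Prod.fst h4
    have h6 : e'.1.1.1.2 = Γ.mul (R.inclArr r) e.1.1.1.2 := congrArg Prod.snd h4
    dsimp only at h3
    obtain ⟨r', h7, h8⟩ := Φ.Y.transitive_right e'.1.1.1.1 (Φ.Y.left.act r e.1.1.1.1)
      (by rw [Φ.Y.left.moment_act _ _ h3, h5])
    have h9 : R'.gpd.tgt r' = Φ.Y.p' e.1.1.1.1 := by
      rw [← Φ.Y.right.moment_act _ _ h7, h8, Φ.Y.p'_left _ _ h3]
    have h10 : Γ'.tgt (R'.inclArr r') = Γ'.src (g e) := by rw [R'.tgt_incl, h9, ← Φ.p'_i, hg]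
    have h11 : Φ.X.p' (Φ.i e'.1.1.1.1) = Γ'.src (R'.inclArr r') := by
      rw [R'.src_incl, ← h7, Φ.p'_i]
    have h12 : Γ.tgt (R.inclArr r) = Φ.X.p (Φ.i e.1.1.1.1) := by rw [R.tgt_incl, h3, Φ.p_i]
    refine Quot.sound ⟨r', h9, Prod.ext h7 (Φ.X.right_cancel (hg e')
      (by rw [Γ'.src_mul _ _ h10, h11]) ?_)⟩
    rw [Φ.X.right.act_mul _ _ _ h11 h10, ← Φ.i_right h7, h8, Φ.i_left h3, Φ.X.comm _ _ _ h12 (hg e),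
      hgx, hgx, ← h2, h6, Φ.X.left.mul_act _ _ _ _ (htgt e)]
    rw [R.tgt_incl, h3, e.1.1.2.1]

/-- Properness is invariant under Morita equivalence. -/
theorem isProperIn_image {S : Set Γ.Obj} (hS : Γ.IsStable S) (h : R.IsProperIn S) :
    R'.IsProperIn (Φ.X.image S) := by
  refine ⟨Φ.isIn_image hS h.isIn, fun K' hK' hK'S => ?_⟩
  have : LocallyCompactSpace Φ.X.X := Manifold.locallyCompact_of_finiteDimensional Φ.X.X.I
  obtain ⟨C, hC, rfl⟩ := Φ.X.isOpenMap_p'.exists_isCompact_image_eq Φ.X.continuous_p'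
    Φ.X.surjective_p' hK'
  refine Φ.compactSpace_quot_image hC (h.compact _ (hC.image Φ.X.continuous_p) ?_)
  rintro _ ⟨x, hx, rfl⟩
  have := hK'S ⟨x, hx, rfl⟩
  rwa [Φ.X.closure_image hS, Φ.X.mem_image_iff hS.closure] at this

end SubgroupoidMoritaEquivalence

theorem mainTheorem6 {𝕜 : Type v} [RCLike 𝕜] {Γ Γ' : LieGroupoid.{v, u} 𝕜}
    (R : LieSubgroupoid Γ) (R' : LieSubgroupoid Γ')
    (Φ : SubgroupoidMoritaEquivalence.{v, u, w} R R')
    (S : Set Γ.Obj) (hS : Γ.Obj.IsEmbeddedSubmanifold S) (hstable : Γ.IsStable S) :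
    (Γ'.Obj.IsEmbeddedSubmanifold (Φ.X.image S) ∧ Γ'.IsStable (Φ.X.image S)) ∧
    (R.IsIn S ↔ R'.IsIn (Φ.X.image S)) ∧
    (R.IsSurjectiveIn S ↔ R'.IsSurjectiveIn (Φ.X.image S)) ∧
    (R.IsFullIn S ↔ R'.IsFullIn (Φ.X.image S)) ∧
    (R.IsProperIn S ↔ R'.IsProperIn (Φ.X.image S)) := by
  have h' : Γ'.IsStable (Φ.X.image S) := Φ.X.isStable_image hstable
  -- Each converse is the direct implication for the inverse equivalence, brought back to `S` by
  -- this identity.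
  have hback : Φ.symm.X.image (Φ.X.image S) = S := Φ.X.symm_image_image hstable
  refine ⟨⟨Φ.X.isEmbeddedSubmanifold_image hstable hS, h'⟩,
    ⟨Φ.isIn_image hstable, fun h => ?_⟩, ⟨Φ.isSurjectiveIn_image hstable, fun h => ?_⟩,
    ⟨Φ.isFullIn_image hstable, fun h => ?_⟩, ⟨Φ.isProperIn_image hstable, fun h => ?_⟩⟩
  · exact hback ▸ Φ.symm.isIn_image h' h
  · exact hback ▸ Φ.symm.isSurjectiveIn_image h' h
  · exact hback ▸ Φ.symm.isFullIn_image h' h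
  · exact hback ▸ Φ.symm.isProperIn_image h' h
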